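/- Let $G$ be a semisimple real Lie group and $P\subset G$ a closed parabolic subgroup that meets every connected component of $G$; thus the Lie algebra has a $|k|$-grading $\mathfrak g=\mathfrak g_{-k}\oplus\cdots\oplus\mathfrak g_k$ with $\mathfrak g_-=\bigoplus_{i<0}\mathfrak g_i$ generated by $\mathfrak g_{-1}$ and $\operatorname{Lie}(P)=\mathfrak p=\bigoplus_{i\ge 0}\mathfrak g_i$; put $\mathfrak p_+=\bigoplus_{i>0}\mathfrak g_i$. Let $V$ be a finite-dimensional irreducible representation of $G$ over $\mathbb R$ or $\mathbb C$, and let $V^0=\mathfrak p_+\cdot V$ be the largest proper component of the $P$-invariant filtration of $V$. Let $(\mathcal G\to M,\omega)$ be a parabolic geometry of type $(G,P)$, i.e. a smooth principal $P$-bundle with a Cartan connection $\omega\in\Omega^1(\mathcal G,\mathfrak g)$. Put $\mathcal V=\mathcal G\times_P V$, with its tractor connection $\nabla$, and $\mathcal H_0=\mathcal G\times_P(V/V^0)$, with the projection $\Pi:\Gamma(\mathcal V)\to\Gamma(\mathcal H_0)$. Let $\Theta_0^V$ be the first BGG operator on $\Gamma(\mathcal H_0)$. A normal solution of $\Theta_0^V$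 is a solution of $\Theta_0^V(\sigma)=0$ of the form $\sigma=\Pi(s)$ with $s\in\Gamma(\mathcal V)$ parallel; view $s$ as a $P$-equivariant function $s:\mathcal G\to V$. Its $G$-type is the $G$-orbit $\mathcal O=G\cdot s(\mathcal G)\subset V$ (that this set is a single $G$-orbit is automatic for $M$ connected, and is part of saying that $\sigma$ has $G$-type $\mathcal O$ in general). The $P$-type of $x\in M$ with respect to $\sigma$ is the $P$-orbit $s(\mathcal G_x)\subset\mathcal O$. For a $P$-invariant linear subspace $U\subset V$, put $\mathcal Z^U(\sigma)=\{x\in M: s(x)\in\mathcal U_x\}$ with $\mathcal U=\mathcal G\times_P U\subset\mathcal V$; for $U=V^0$ this is the zero set of $\sigma$. Let $\sigma$ be a normal solution of $\Theta_0^V$ on $(\mathcal G\to M,\omega)$ of $G$-type $\mathcal O$, and let $x\in M$ be any point. Then there is a normal solution $\sigma'$, of $G$-type $\mathcal O$, on the homogeneous model $(G\to G/P,\omega^{MC})$, where $\omega^{MC}$ is the left Maurer–Cartan form, such that $eP\in G/P$ has the same $P$-type with respect to $\sigma'$ that $x$ has with respect to $\sigma$. Further, there are open neighbourhoods $N$ of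 $x$ in $M$ and $N'$ of $eP$ in $G/P$ and a diffeomorphism $\varphi:N\to N'$ such that $\varphi(x)=eP$ and $$\varphi(\mathcal Z^U(\sigma)\cap N)=\mathcal Z^U(\sigma')\cap N'$$ for every $P$-invariant linear subspace $U\subset V$. -/

import Mathlib

open scoped Manifold ContDiff

noncomputable section

namespace BGG

section Groups

variable {EG : Type*} [NormedAddCommGroup EG] [NormedSpace ℝ EG]
  {G : Type*} [TopologicalSpace G] [ChartedSpace EG G] [Group G]

/-- The adjoint action of `g : G` on the Lie algebra: the derivative at `1` of `h ↦ g h g⁻¹`. -/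
def Ad (g : G) : GroupLieAlgebra 𝓘(ℝ, EG) G →L[ℝ] GroupLieAlgebra 𝓘(ℝ, EG) G :=
  mfderiv 𝓘(ℝ, EG) 𝓘(ℝ, EG) (fun h : G => g * h * g⁻¹) 1

/-- The left Maurer–Cartan form `ω_g(ξ) = T(h ↦ g⁻¹ h) ξ`. -/
def maurerCartan (g : G) : TangentSpace 𝓘(ℝ, EG) g →L[ℝ] GroupLieAlgebra 𝓘(ℝ, EG) G :=
  mfderiv 𝓘(ℝ, EG) 𝓘(ℝ, EG) (fun h : G => g⁻¹ * h) g

variable {EP : Type*} [NormedAddCommGroup EP] [NormedSpace ℝ EP]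

/-- The derivative at the identity of the inclusion of a subgroup `P` of `G`. -/
def inclDeriv (P : Subgroup G) [ChartedSpace EP P] :
    GroupLieAlgebra 𝓘(ℝ, EP) P →L[ℝ] GroupLieAlgebra 𝓘(ℝ, EG) G :=
  mfderiv 𝓘(ℝ, EP) 𝓘(ℝ, EG) (Subtype.val : P → G) 1

/-- `P` is a closed subgroup of `G`, carries the manifold structure of an embedded submanifold,
and meets every connected component of `G`. -/
structure IsClosedLieSubgroup (P : Subgroup G) [ChartedSpace EP P] : Prop where
  isClosed : IsClosed (P : Set G)
  isSmoothEmbedding :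
    Manifold.IsSmoothEmbedding 𝓘(ℝ, EP) 𝓘(ℝ, EG) ∞ (Subtype.val : P → G)
  meets_components : ∀ g : G, ∃ p ∈ P, p ∈ connectedComponent g

/-- A smooth Lie group is regular enough for its Lie algebra to be defined. -/
instance instLieGroupMinSmoothness [LieGroup 𝓘(ℝ, EG) ∞ G] :
    LieGroup 𝓘(ℝ, EG) (minSmoothness ℝ 3) G :=
  LieGroup.of_le (n := ∞) (by rw [minSmoothness_of_isRCLikeNormedField]; exact ENat.LEInfty.out)

variable [CompleteSpace EG] [LieGroup 𝓘(ℝ, EG) ∞ G]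

/-- A `|k|`-grading `𝔤 = 𝔤₋ₖ ⊕ ⋯ ⊕ 𝔤ₖ` of the Lie algebra of `G`, with `𝔤₋` generated by `𝔤₋₁`,
whose non-negative part is the Lie algebra of `P`. For `𝔤` semisimple and `P` closed this exhibits
`P` as a parabolic subgroup of `G`. -/
structure ParabolicGrading (P : Subgroup G) [ChartedSpace EP P] where
  k : ℕ
  grade : ℤ → Submodule ℝ (GroupLieAlgebra 𝓘(ℝ, EG) G)
  isInternal : DirectSum.IsInternal grade
  lie_mem : ∀ (i j : ℤ) (X Y : GroupLieAlgebra 𝓘(ℝ, EG) G),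
    X ∈ grade i → Y ∈ grade j → ⁅X, Y⁆ ∈ grade (i + j)
  eq_bot : ∀ i : ℤ, (k : ℤ) < |i| → grade i = ⊥
  generated : (LieSubalgebra.lieSpan ℝ (GroupLieAlgebra 𝓘(ℝ, EG) G)
      (grade (-1) : Set (GroupLieAlgebra 𝓘(ℝ, EG) G))).toSubmodule =
    ⨆ (i : ℤ) (_ : i < 0), grade i
  lieAlgebra_eq : LinearMap.range (inclDeriv (EG := EG) (EP := EP) P).toLinearMap =
    ⨆ (i : ℤ) (_ : 0 ≤ i), grade i

/-- The nilradical `𝔭₊ = 𝔤₁ ⊕ ⋯ ⊕ 𝔤ₖ` of the parabolic subalgebra. -/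
def ParabolicGrading.nilradical {P : Subgroup G} [ChartedSpace EP P]
    (Γ : ParabolicGrading (EG := EG) (EP := EP) P) :
    Submodule ℝ (GroupLieAlgebra 𝓘(ℝ, EG) G) :=
  ⨆ (i : ℤ) (_ : 0 < i), Γ.grade i

end Groups

section Representations

variable {EG : Type*} [NormedAddCommGroup EG] [NormedSpace ℝ EG]
  {G : Type*} [TopologicalSpace G] [ChartedSpace EG G] [Group G]
  {V : Type*} [NormedAddCommGroup V] [NormedSpace ℝ V]

/-- The infinitesimal representation `𝔤 → End V` of `ρ`. -/
def infRep (ρ : G →* (V →L[ℝ] V)) : GroupLieAlgebra 𝓘(ℝ, EG) G →L[ℝ] (V →L[ℝ] V) :=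
  mfderiv 𝓘(ℝ, EG) 𝓘(ℝ, V →L[ℝ] V) (fun g => ρ g) 1

/-- `ρ` is an irreducible representation over `𝕜` (which is `ℝ` or `ℂ`): it is `𝕜`-linear, `V` is
non-zero, and `V` has no proper non-zero `G`-invariant `𝕜`-subspace. -/
structure IsIrreducibleRep (𝕜 : Type*) [RCLike 𝕜] [Module 𝕜 V] (ρ : G →* (V →L[ℝ] V)) :
    Prop where
  map_smul : ∀ (g : G) (c : 𝕜) (v : V), ρ g (c • v) = c • ρ g v
  nontrivial : Nontrivial V
  eq_bot_or_eq_top : ∀ W : Submodule 𝕜 V, (∀ (g : G), ∀ w ∈ W, ρ g w ∈ W) → W = ⊥ ∨ W = ⊤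

/-- `U ⊆ V` is invariant under the subgroup `P`. -/
def IsInvariant (P : Subgroup G) (ρ : G →* (V →L[ℝ] V)) (U : Submodule ℝ V) : Prop :=
  ∀ p ∈ P, ∀ v ∈ U, ρ p v ∈ U

/-- `O ⊆ V` is a `G`-orbit. -/
def IsOrbit (ρ : G →* (V →L[ℝ] V)) (O : Set V) : Prop :=
  ∃ v : V, O = Set.range fun g : G => ρ g v

variable {EP : Type*} [NormedAddCommGroup EP] [NormedSpace ℝ EP]
  [CompleteSpace EG] [LieGroup 𝓘(ℝ, EG) ∞ G] {P : Subgroup G} [ChartedSpace EP P]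
  (Γ : ParabolicGrading (EG := EG) (EP := EP) P) (ρ : G →* (V →L[ℝ] V))

/-- The largest proper component `V⁰ = 𝔭₊ · V` of the filtration of an irreducible `V` determined
by `P` (the sum of all eigenspaces of the grading element other than the lowest one). -/
def filtTop : Submodule ℝ V :=
  Submodule.span ℝ {w | ∃ Z ∈ Γ.nilradical, ∃ v : V, w = infRep (EG := EG) ρ Z v}

/-- `φ : 𝔤 → V` lies in `Hom(𝔤/𝔭, V) ≅ 𝔭₊ ⊗ V` (identification by the Killing form `B`) and is
annihilated by the Kostant codifferential `∂*(Z ⊗ v) = - Z · v`. -/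
def IsCoclosed (φ : GroupLieAlgebra 𝓘(ℝ, EG) G → V) : Prop :=
  ∃ (n : ℕ) (Z : Fin n → GroupLieAlgebra 𝓘(ℝ, EG) G) (v : Fin n → V),
    (∀ i, Z i ∈ Γ.nilradical) ∧
    (∀ X, φ X = ∑ i, killingForm ℝ (GroupLieAlgebra 𝓘(ℝ, EG) G) (Z i) X • v i) ∧
    ∑ i, -(infRep (EG := EG) ρ (Z i) (v i)) = 0

/-- The image in `Hom(𝔤/𝔭, V) ≅ 𝔭₊ ⊗ V` of the Kostant codifferential
`∂*(Z ∧ W ⊗ v) = - W ⊗ Z · v + Z ⊗ W · v - [Z, W] ⊗ v` on `Λ² 𝔭₊ ⊗ V`. -/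
def codiffImage : Submodule ℝ (GroupLieAlgebra 𝓘(ℝ, EG) G → V) :=
  Submodule.span ℝ {φ | ∃ Z ∈ Γ.nilradical, ∃ W ∈ Γ.nilradical, ∃ v : V, ∀ X,
    φ X = -(killingForm ℝ (GroupLieAlgebra 𝓘(ℝ, EG) G) W X • infRep (EG := EG) ρ Z v)
      + killingForm ℝ (GroupLieAlgebra 𝓘(ℝ, EG) G) Z X • infRep (EG := EG) ρ W v
      - killingForm ℝ (GroupLieAlgebra 𝓘(ℝ, EG) G) ⁅Z, W⁆ X • v}

end Representations

section Cartan

variable {EG : Type*} [NormedAddCommGroup EG] [NormedSpace ℝ EG]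
  {G : Type*} [TopologicalSpace G] [ChartedSpace EG G] [Group G]
  {EP : Type*} [NormedAddCommGroup EP] [NormedSpace ℝ EP]
  {P : Subgroup G} [ChartedSpace EP P]
  {EB : Type*} [NormedAddCommGroup EB] [NormedSpace ℝ EB]
  {B : Type*} [TopologicalSpace B] [ChartedSpace EB B]
  {EM : Type*} [NormedAddCommGroup EM] [NormedSpace ℝ EM]
  {M : Type*} [TopologicalSpace M] [ChartedSpace EM M]
  {V : Type*} [NormedAddCommGroup V] [NormedSpace ℝ V]

variable (EG P EB B M) in
/-- The data of a Cartan geometry of type `(G, P)` on `M`: the projection and the right action of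
`P` on the total space `B`, and a `𝔤`-valued one-form on `B`. -/
structure CartanData where
  proj : B → M
  act : B → P → B
  form : ∀ u : B, TangentSpace 𝓘(ℝ, EB) u →L[ℝ] GroupLieAlgebra 𝓘(ℝ, EG) G

/-- The one-form of `C` as a map on the tangent bundle, with values in the model space of `𝔤`. -/
def CartanData.formMap (C : CartanData EG P EB B M) (ξ : TangentBundle 𝓘(ℝ, EB) B) : EG :=
  C.form ξ.proj ξ.snd

variable (EP EM) in
/-- `C` is a Cartan geometry: `C.proj : B → M` is a smooth principal `P`-bundle, and `C.form` is a
smooth Cartan connection on it. -/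
structure IsCartanGeometry [IsManifold 𝓘(ℝ, EB) ∞ B] (C : CartanData EG P EB B M) : Prop where
  act_one : ∀ u, C.act u 1 = u
  act_mul : ∀ u p q, C.act u (p * q) = C.act (C.act u p) q
  contMDiff_act : ContMDiff (𝓘(ℝ, EB).prod 𝓘(ℝ, EP)) 𝓘(ℝ, EB) ∞
    fun z : B × P => C.act z.1 z.2
  contMDiff_proj : ContMDiff 𝓘(ℝ, EB) 𝓘(ℝ, EM) ∞ C.proj
  /-- Local triviality: `Ψ` is a `P`-equivariant diffeomorphism from `N × P` onto the part of `B`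
  over `N`, compatible with the projections. -/
  locally_trivial : ∀ x : M, ∃ (N : Set M) (Ψ : OpenPartialHomeomorph (M × P) B),
    IsOpen N ∧ x ∈ N ∧ Ψ.source = N ×ˢ Set.univ ∧ Ψ.target = C.proj ⁻¹' N ∧
    ContMDiffOn (𝓘(ℝ, EM).prod 𝓘(ℝ, EP)) 𝓘(ℝ, EB) ∞ Ψ Ψ.source ∧
    ContMDiffOn 𝓘(ℝ, EB) (𝓘(ℝ, EM).prod 𝓘(ℝ, EP)) ∞ Ψ.symm Ψ.target ∧
    (∀ y ∈ N, ∀ p : P, C.proj (Ψ (y, p)) = y) ∧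
    (∀ y ∈ N, ∀ p q : P, Ψ (y, p * q) = C.act (Ψ (y, p)) q)
  contMDiff_form : ContMDiff 𝓘(ℝ, EB).tangent 𝓘(ℝ, EG) ∞
    C.formMap
  form_act : ∀ (u : B) (p : P) (ξ : TangentSpace 𝓘(ℝ, EB) u),
    C.form (C.act u p) (mfderiv 𝓘(ℝ, EB) 𝓘(ℝ, EB) (fun w => C.act w p) u ξ) =
      Ad ((p : G)⁻¹) (C.form u ξ)
  form_fundamental : ∀ (u : B) (Y : GroupLieAlgebra 𝓘(ℝ, EP) P),
    C.form (C.act u 1) (mfderiv 𝓘(ℝ, EP) 𝓘(ℝ, EB) (fun p : P => C.act u p) 1 Y) =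
      inclDeriv (EG := EG) P Y
  form_bijective : ∀ u : B, Function.Bijective (C.form u)

variable (EG P) in
/-- The homogeneous model `(G → G/P, ω^MC)`. -/
def homogeneousModel : CartanData EG P EG G (G ⧸ P) where
  proj g := (g : G ⧸ P)
  act g p := g * p
  form := maurerCartan

/-- A smooth section of the tractor bundle `B ×_P V`, as a `P`-equivariant function `B → V`. -/
structure IsTractorSection (C : CartanData EG P EB B M) (ρ : G →* (V →L[ℝ] V)) (s : B → V) :
    Prop where
  contMDiff : ContMDiff 𝓘(ℝ, EB) 𝓘(ℝ, V) ∞ s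
  equivariant : ∀ (u : B) (p : P), s (C.act u p) = ρ ((p : G)⁻¹) (s u)

/-- The differential of a vector-valued function. -/
def diff (s : B → V) (u : B) : TangentSpace 𝓘(ℝ, EB) u →L[ℝ] V :=
  mfderiv 𝓘(ℝ, EB) 𝓘(ℝ, V) s u

/-- The tractor connection, `∇_ξ s = ds(ξ) + ω(ξ) · s` with `ω = C.form`, in terms of
equivariant functions. -/
def tractorDeriv (C : CartanData EG P EB B M) (ρ : G →* (V →L[ℝ] V)) (s : B → V) (u : B)
    (ξ : TangentSpace 𝓘(ℝ, EB) u) : V :=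
  diff s u ξ + infRep (EG := EG) ρ (C.form u ξ) (s u)

/-- A parallel section of the tractor bundle. -/
structure IsParallelSection (C : CartanData EG P EB B M) (ρ : G →* (V →L[ℝ] V)) (s : B → V) :
    Prop extends IsTractorSection C ρ s where
  parallel : ∀ u ξ, tractorDeriv C ρ s u ξ = 0

section Solutions

variable [CompleteSpace EG] [LieGroup 𝓘(ℝ, EG) ∞ G]
  (C : CartanData EG P EB B M) (Γ : ParabolicGrading (EG := EG) (EP := EP) P)
  (ρ : G →* (V →L[ℝ] V))

/-- `L` is the image under the BGG splitting operator of the section `σ` of `H₀ = V/V⁰`: the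
section of the tractor bundle with `Π(L) = σ` and `∂* ∇ L = 0`. -/
structure IsSplitting (σ : B → V ⧸ filtTop Γ ρ) (L : B → V) : Prop
    extends IsTractorSection C ρ L where
  proj_eq : ∀ u, (filtTop Γ ρ).mkQ (L u) = σ u
  coclosed : ∀ u, ∃ φ : GroupLieAlgebra 𝓘(ℝ, EG) G → V, IsCoclosed Γ ρ φ ∧
    ∀ ξ, tractorDeriv C ρ L u ξ = φ (C.form u ξ)

/-- `σ` lies in the kernel of the first BGG operator `Θ₀^V`, which maps `σ` to the class of `∇ L` in
`H₁ = ker ∂* / im ∂*`, where `L` is the image of `σ` under the splitting operator. -/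
def IsBGGSolution (σ : B → V ⧸ filtTop Γ ρ) : Prop :=
  ∃ L : B → V, IsSplitting C Γ ρ σ L ∧
    ∀ u, ∃ φ ∈ codiffImage Γ ρ, ∀ ξ, tractorDeriv C ρ L u ξ = φ (C.form u ξ)

/-- A normal solution: a solution `σ` of the first BGG operator of the form `σ = Π(s)` with `s` a
parallel section of the tractor bundle. -/
structure NormalSolution where
  σ : B → V ⧸ filtTop Γ ρ
  isSolution : IsBGGSolution C Γ ρ σ
  s : B → V
  isParallel : IsParallelSection C ρ s
  proj_eq : ∀ u, (filtTop Γ ρ).mkQ (s u) = σ u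

namespace NormalSolution

variable {C Γ ρ} (σ : NormalSolution C Γ ρ)

/-- `σ` has `G`-type `O`: the `G`-equivariant extension `[u, g] ↦ g⁻¹ · s(u)` of `s` has the
`G`-orbit `O` as image. -/
def HasGType (O : Set V) : Prop :=
  IsOrbit ρ O ∧ Set.range (fun z : B × G => ρ z.2⁻¹ (σ.s z.1)) = O

/-- The `P`-type of the point `x`: the `P`-orbit `s(B_x)`. -/
def pType (x : M) : Set V := σ.s '' {u | C.proj u = x}

/-- `Z^U(σ)`: the points `x` at which the parallel section `s` has its value in `U_x`. -/
def zeroLocus (U : Submodule ℝ V) : Set M := {x | ∃ u, C.proj u = x ∧ σ.s u ∈ U}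

end NormalSolution

end Solutions

end Cartan

end BGG

end

/-!
The parallel section `s` takes the value `v₀ = s(u₀)` at a point `u₀` over `x`. On the homogeneous
model, `s'(g) = ρ(g⁻¹) v₀` is parallel, hence gives a normal solution `σ'` of the same `G`-type, and
the `P`-types agree because both are `ρ(P) v₀`. It remains to compare `s` and `s'` over
neighbourhoods of `x` and `eP`.

The comparison rests on a local lift `BGG.exists_local_lift`: along a smooth map `τ` into the total
space with `τ(z₀) = u₀` there is a smooth `g` into `G` with `g(z₀) = 1`, with derivative
`ω ∘ dτ` at `z₀`, and with `s(τ z) = s'(g z)` near `z₀`. Let `L(X) = X · v₀`, let `r` be a linear map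
with `L r L = L`, and put `a = L r`, a projection onto `𝔤 · v₀`. In a chart `c` of `G` at `1`, the map
`κ(g) = c(g) - r L c(g) - r s'(g)` has the identity as derivative at `1`, because
`ds' = -L` there. It therefore has a smooth local inverse, and `g` is obtained by solving
`κ(g) = b`, where `b` is built in the same way from an affine map with derivative `ω ∘ dτ` and from
`s ∘ τ`. Applying `L` gives `a s'(g) = a s(τ)`. The difference `D = s ∘ τ - s' ∘ g` satisfies
`dD(ξ) = -ω(dτ ξ) · D + w` with `w ∈ 𝔤 · s'(g)` and `a(dD) = 0`. As
`𝔤 · s'(g) = ρ(g⁻¹)(𝔤 · v₀)`, the projection `a` is bounded below on it for `g` near `1`, so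
that `‖dD(ξ)‖` is bounded by a multiple of `‖ξ‖ ‖D‖`, and Grönwall's inequality gives `D = 0`. No integrability
of the curved geometry is used, and no exponential map.

Taking for `τ` a local section of the bundle, composed with the inverse of a chart of `M`, the map
`z ↦ g(z) P` has a bijective derivative, since `ω` identifies the vertical vectors with the Lie
algebra of `P`, which is the kernel of `T₁G → T(G/P)`. The inverse function theorem turns it into the
diffeomorphism `φ` of `BGG.exists_local_comparison`. At corresponding points `s` and `s'` have
values in the same `P`-orbit, so one lies in a `P`-invariant subspace if and only if the other does.
-/

/-! ### The inverse function theorem on manifolds -/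

section InverseFunction

open Set Filter Topology

variable {E : Type*} [NormedAddCommGroup E] [NormedSpace ℝ E] [FiniteDimensional ℝ E]
  {F : Type*} [NormedAddCommGroup F] [NormedSpace ℝ F]
  {M : Type*} [TopologicalSpace M] [ChartedSpace E M] [IsManifold 𝓘(ℝ, E) ∞ M]
  {N : Type*} [TopologicalSpace N] [ChartedSpace F N] [IsManifold 𝓘(ℝ, F) ∞ N]

/-- The inverse function theorem with both maps smooth on the whole of their domains. Smoothness and
invertibility of the derivative hold on a neighbourhood of `a`, to which the local inverse is
restricted; `ContDiffAt ℝ ∞` at `a` alone would not give smoothness on a fixed neighbourhood. -/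
theorem exists_local_inverse_of_contDiff {f : E → F} {a : E}
    (hf : ∀ᶠ z in 𝓝 a, ContDiffAt ℝ ∞ f z) {f' : E →L[ℝ] F} (hf' : HasFDerivAt f f' a)
    (hbij : Function.Bijective f') :
    ∃ φ : OpenPartialHomeomorph E F, a ∈ φ.source ∧ (φ : E → F) = f ∧
      ContDiffOn ℝ ∞ φ φ.source ∧ ContDiffOn ℝ ∞ φ.symm φ.target := by
  have : CompleteSpace E := FiniteDimensional.complete ℝ E
  let e₀ : E ≃L[ℝ] F := (LinearEquiv.ofBijective f'.toLinearMap hbij).toContinuousLinearEquiv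
  have he₀ : (e₀ : E →L[ℝ] F) = f' := by ext; rfl
  have ha := hf.self_of_nhds
  have hne : (∞ : ℕ∞ω) ≠ 0 := by simp
  have hf'' : HasFDerivAt f (e₀ : E →L[ℝ] F) a := by rwa [he₀]
  let φ₀ := ha.toOpenPartialHomeomorph f hf'' hne
  have hcont : ContinuousAt (fderiv ℝ f) a :=
    (ha.fderiv_right (m := 0) (by simp)).continuousAt
  have hinv : ∀ᶠ z in 𝓝 a, fderiv ℝ f z ∈ range ((↑) : (E ≃L[ℝ] F) → E →L[ℝ] F) := by
    apply hcont.eventually_mem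
    rw [hf''.fderiv]
    exact e₀.nhds
  obtain ⟨W, hW, hWo, haW⟩ := eventually_nhds_iff.1 (hf.and hinv)
  refine ⟨φ₀.restrOpen W hWo, ⟨ha.mem_toOpenPartialHomeomorph_source hf'' hne, haW⟩, rfl, ?_, ?_⟩
  · intro z hz
    exact (hW z hz.2).1.contDiffWithinAt
  · intro w hw
    have hz := (φ₀.restrOpen W hWo).map_target hw
    obtain ⟨h1, e, he⟩ := hW _ hz.2
    refine ContDiffAt.contDiffWithinAt ?_
    refine OpenPartialHomeomorph.contDiffAt_symm _ hw (f₀' := e) ?_ h1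
    rw [he]
    exact (h1.differentiableAt hne).hasFDerivAt

/-- The inverse function theorem for maps between manifolds. -/
theorem exists_local_diffeomorphism {f : M → N} {x : M}
    (hf : ∀ᶠ y in 𝓝 x, ContMDiffAt 𝓘(ℝ, E) 𝓘(ℝ, F) ∞ f y)
    {f' : TangentSpace 𝓘(ℝ, E) x →L[ℝ] TangentSpace 𝓘(ℝ, F) (f x)}
    (hf' : HasMFDerivAt 𝓘(ℝ, E) 𝓘(ℝ, F) f x f') (hbij : Function.Bijective f') :
    ∃ φ : OpenPartialHomeomorph M N, x ∈ φ.source ∧ EqOn φ f φ.source ∧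
      ContMDiffOn 𝓘(ℝ, E) 𝓘(ℝ, F) ∞ φ φ.source ∧
      ContMDiffOn 𝓘(ℝ, F) 𝓘(ℝ, E) ∞ φ.symm φ.target := by
  set c := chartAt E x
  set d := chartAt F (f x)
  have hxc : x ∈ c.source := mem_chart_source E x
  have hxd : f x ∈ d.source := mem_chart_source F (f x)
  have hder : HasFDerivAt (d ∘ f ∘ c.symm) (f' : E →L[ℝ] F) (c x) := by
    have := hf'.2
    simp only [writtenInExtChartAt, mfld_simps] at this
    exact hasFDerivWithinAt_univ.1 this
  obtain ⟨W, hW, hWo, hxW⟩ := eventually_nhds_iff.1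
    (hf.and (hf.self_of_nhds.continuousAt.eventually_mem (d.open_source.mem_nhds hxd)))
  have hsm : ∀ᶠ z in 𝓝 (c x), ContDiffAt ℝ ∞ (d ∘ f ∘ c.symm) z := by
    have h1 : ∀ᶠ z in 𝓝 (c x), c.symm z ∈ W := by
      apply (c.continuousAt_symm (c.map_source hxc)).eventually_mem
      rw [c.left_inv hxc]
      exact hWo.mem_nhds hxW
    filter_upwards [h1, c.open_target.mem_nhds (c.map_source hxc)] with z hz hzt
    rw [← contMDiffAt_iff_contDiffAt]
    refine ContMDiffAt.comp z (contMDiffOn_chart.contMDiffAt (d.open_source.mem_nhds (hW _ hz).2))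
      (ContMDiffAt.comp z (hW _ hz).1 ?_)
    exact contMDiffOn_chart_symm.contMDiffAt (c.open_target.mem_nhds hzt)
  obtain ⟨ψ, hψ, hψf, -, hψ2⟩ := exists_local_inverse_of_contDiff hsm hder hbij
  let φ₀ := (c.trans ψ).trans d.symm
  let φ := φ₀.restrOpen W hWo
  have key : ∀ y ∈ φ.source, φ y = f y := by
    intro y hy
    have h1 : y ∈ c.source := hy.1.1.1
    have h2 : f y ∈ d.source := (hW y hy.2).2
    change d.symm (ψ (c y)) = f y
    rw [hψf]
    simp [c.left_inv h1, d.left_inv h2]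
  refine ⟨φ, ⟨⟨⟨hxc, hψ⟩, ?_⟩, hxW⟩, key, ?_, ?_⟩
  · change ψ (c x) ∈ d.target
    rw [hψf]
    simpa [c.left_inv hxc] using d.map_source hxd
  · intro y hy
    exact (hW y hy.2).1.contMDiffWithinAt.congr (fun z hz => key z hz) (key y hy)
  · have h1 : ContMDiffOn 𝓘(ℝ, F) 𝓘(ℝ, F) ∞ d d.source := contMDiffOn_chart
    have h2 : ContMDiffOn 𝓘(ℝ, E) 𝓘(ℝ, E) ∞ c.symm c.target := contMDiffOn_chart_symm
    have h3 : ContMDiffOn 𝓘(ℝ, F) 𝓘(ℝ, E) ∞ ψ.symm ψ.target := hψ2.contMDiffOn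
    intro w hw
    have hw1 : w ∈ φ₀.target := by
      have := φ.map_target hw
      have h4 := φ₀.map_source (this.1)
      have h5 : φ₀ (φ.symm w) = w := φ.right_inv hw
      rwa [h5] at h4
    have hwd : w ∈ d.source := hw1.1
    have hwψ : d w ∈ ψ.target := hw1.2.1
    have hwc : ψ.symm (d w) ∈ c.target := hw1.2.2
    refine ContMDiffAt.contMDiffWithinAt ?_
    change ContMDiffAt _ _ _ (c.symm ∘ ψ.symm ∘ d) w
    exact (h2.contMDiffAt (c.open_target.mem_nhds hwc)).comp w
      ((h3.contMDiffAt (ψ.open_target.mem_nhds hwψ)).comp w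
        (h1.contMDiffAt (d.open_source.mem_nhds hwd)))

end InverseFunction

/-! ### Uniqueness for linear differential inequalities, and generalized inverses -/

section LinearAnalysis

open Set Filter Topology

variable {E : Type*} [NormedAddCommGroup E] [NormedSpace ℝ E]
  {V : Type*} [NormedAddCommGroup V] [NormedSpace ℝ V]

/-- Grönwall's inequality along the segments from `z₀`. -/
theorem eventually_eq_zero_of_norm_fderiv_le {D : E → V} {z₀ : E} {C : ℝ}
    (hdiff : ∀ᶠ z in 𝓝 z₀, DifferentiableAt ℝ D z)
    (hbound : ∀ᶠ z in 𝓝 z₀, ∀ ξ, ‖fderiv ℝ D z ξ‖ ≤ C * ‖ξ‖ * ‖D z‖) (h0 : D z₀ = 0) :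
    ∀ᶠ z in 𝓝 z₀, D z = 0 := by
  obtain ⟨ε, hε, hball⟩ := Metric.eventually_nhds_iff_ball.1 (hdiff.and hbound)
  filter_upwards [Metric.ball_mem_nhds z₀ hε] with z hz
  have hmem : ∀ t ∈ Icc (0 : ℝ) 1, z₀ + t • (z - z₀) ∈ Metric.ball z₀ ε := by
    intro t ht
    have := (convex_ball z₀ ε).add_smul_sub_mem (Metric.mem_ball_self hε) hz ht
    exact this
  have hder : ∀ t ∈ Icc (0 : ℝ) 1, HasDerivAt (fun t : ℝ => D (z₀ + t • (z - z₀)))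
      (fderiv ℝ D (z₀ + t • (z - z₀)) (z - z₀)) t := by
    intro t ht
    have hl : HasDerivAt (fun t : ℝ => z₀ + t • (z - z₀)) (z - z₀) t := by
      simpa using ((hasDerivAt_id t).smul_const (z - z₀)).const_add z₀
    exact (hball _ (hmem t ht)).1.hasFDerivAt.comp_hasDerivAt t hl
  have := eq_zero_of_abs_deriv_le_mul_abs_self_of_eq_zero_right
    (f := fun t : ℝ => D (z₀ + t • (z - z₀))) (K := C * ‖z - z₀‖)
    (fun t ht => (hder t ht).continuousAt.continuousWithinAt)
    (fun t ht => (hder t (Ico_subset_Icc_self ht)).hasDerivWithinAt) (by simpa using h0)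
    (fun t ht => (hball _ (hmem t (Ico_subset_Icc_self ht))).2 _) 1 (by simp)
  simpa using this

/-- Existence of a generalized inverse `r` of `L`; the composition `L ∘ r` is then a projection onto
the range of `L`. -/
theorem exists_generalized_inverse [FiniteDimensional ℝ V] (L : E →L[ℝ] V) :
    ∃ r : V →L[ℝ] E, ∀ X, L (r (L X)) = L X := by
  obtain ⟨q, hq⟩ := L.toLinearMap.rangeRestrict.exists_rightInverse_of_surjective
    L.toLinearMap.range_rangeRestrict
  obtain ⟨r, hr⟩ := LinearMap.exists_extend q
  refine ⟨LinearMap.toContinuousLinearMap r, fun X => ?_⟩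
  have h1 : r (L X) = q (L.toLinearMap.rangeRestrict X) :=
    DFunLike.congr_fun hr (L.toLinearMap.rangeRestrict X)
  have h2 := DFunLike.congr_fun hq (L.toLinearMap.rangeRestrict X)
  have h3 := congrArg Subtype.val h2
  change L (r (L X)) = L X
  rw [h1]
  exact h3

/-- If `R` is close to the identity, then a projection `a` is bounded below on the image under `R` of
its range. -/
theorem norm_le_of_norm_sub_one_le {a R : V →L[ℝ] V} (hR : ‖a‖ * ‖R - 1‖ ≤ 1 / 2) {t : V}
    (ht : a t = t) : ‖R t‖ ≤ 2 * ‖R‖ * ‖a (R t)‖ := by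
  have h1 : ‖t‖ ≤ ‖a (R t)‖ + ‖a ((R - 1) t)‖ := by
    have : t = a (R t) - a ((R - 1) t) := by simp [ht]
    calc ‖t‖ = ‖a (R t) - a ((R - 1) t)‖ := by rw [← this]
      _ ≤ _ := norm_sub_le _ _
  have h2 : ‖a ((R - 1) t)‖ ≤ 1 / 2 * ‖t‖ :=
    calc _ ≤ ‖a‖ * (‖R - 1‖ * ‖t‖) :=
          (a.le_opNorm _).trans (by gcongr; exact (R - 1).le_opNorm _)
      _ = ‖a‖ * ‖R - 1‖ * ‖t‖ := by ring
      _ ≤ _ := by gcongr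
  calc ‖R t‖ ≤ ‖R‖ * ‖t‖ := R.le_opNorm _
    _ ≤ ‖R‖ * (2 * ‖a (R t)‖) := by gcongr; linarith
    _ = _ := by ring

end LinearAnalysis

namespace BGG

open Set Filter Topology

/-! ### Infinitesimal representations and orbit maps -/

section Representations

variable {EG : Type*} [NormedAddCommGroup EG] [NormedSpace ℝ EG]
  {G : Type*} [Group G]
  {V : Type*} [NormedAddCommGroup V] [NormedSpace ℝ V]
  {ρ : G →* (V →L[ℝ] V)}

theorem rep_apply_apply (g h : G) (v : V) : ρ g (ρ h v) = ρ (g * h) v := by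
  rw [map_mul]
  rfl

variable [TopologicalSpace G] [ChartedSpace EG G]

theorem hasMFDerivAt_infRep (hρ : ContMDiff 𝓘(ℝ, EG) 𝓘(ℝ, V →L[ℝ] V) ∞ (fun g => ρ g)) :
    HasMFDerivAt 𝓘(ℝ, EG) 𝓘(ℝ, V →L[ℝ] V) (fun g => ρ g) 1 (infRep (EG := EG) ρ) :=
  ((hρ 1).mdifferentiableAt (by simp)).hasMFDerivAt

variable [CompleteSpace V] in
theorem hasMFDerivAt_rep_inv (hρ : ContMDiff 𝓘(ℝ, EG) 𝓘(ℝ, V →L[ℝ] V) ∞ (fun g => ρ g)) :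
    HasMFDerivAt 𝓘(ℝ, EG) 𝓘(ℝ, V →L[ℝ] V) (fun g => ρ g⁻¹) 1 (-(infRep (EG := EG) ρ)) := by
  have h1 := hasFDerivAt_ringInverse (𝕜 := ℝ) (1 : (V →L[ℝ] V)ˣ)
  have h2 : HasFDerivAt (Ring.inverse : (V →L[ℝ] V) → (V →L[ℝ] V))
      (-ContinuousLinearMap.id ℝ (V →L[ℝ] V)) (ρ 1) := by
    rw [map_one]
    exact h1.congr_fderiv (by ext; simp)
  have h3 := HasMFDerivAt.comp (1 : G) h2.hasMFDerivAt (hasMFDerivAt_infRep hρ)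
  have h4 : (Ring.inverse ∘ fun g => ρ g) = fun g : G => ρ g⁻¹ := by
    ext1 g
    exact Ring.inverse_unit (Units.map ρ (toUnits g))
  rw [h4] at h3
  exact h3

variable [LieGroup 𝓘(ℝ, EG) ∞ G]

theorem hasMFDerivAt_maurerCartan (g : G) :
    HasMFDerivAt 𝓘(ℝ, EG) 𝓘(ℝ, EG) (fun h : G => g⁻¹ * h) g (maurerCartan g) :=
  ((contMDiff_mul_left (I := 𝓘(ℝ, EG)) (n := ∞) (a := g⁻¹) g).mdifferentiableAt
    (by simp)).hasMFDerivAt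

theorem maurerCartan_one :
    maurerCartan (1 : G) = ContinuousLinearMap.id ℝ (GroupLieAlgebra 𝓘(ℝ, EG) G) := by
  have h := hasMFDerivAt_maurerCartan (EG := EG) (1 : G)
  refine hasMFDerivAt_unique h ?_
  exact (hasMFDerivAt_id (1 : G)).congr_of_eventuallyEq (.of_forall fun g => by simp)

theorem hasMFDerivAt_Ad (g : G) :
    HasMFDerivAt 𝓘(ℝ, EG) 𝓘(ℝ, EG) (fun h : G => g * h * g⁻¹) 1 (Ad (EG := EG) g) :=
  ((((contMDiff_mul_right (I := 𝓘(ℝ, EG)) (n := ∞) (a := g⁻¹)).comp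
    (contMDiff_mul_left (I := 𝓘(ℝ, EG)) (n := ∞) (a := g))) 1).mdifferentiableAt
    (by simp)).hasMFDerivAt

theorem contMDiff_rep_inv (hρ : ContMDiff 𝓘(ℝ, EG) 𝓘(ℝ, V →L[ℝ] V) ∞ (fun g => ρ g)) :
    ContMDiff 𝓘(ℝ, EG) 𝓘(ℝ, V →L[ℝ] V) ∞ (fun g => ρ g⁻¹) :=
  hρ.comp (contMDiff_inv 𝓘(ℝ, EG) ∞)

theorem contMDiff_rep_inv_apply (hρ : ContMDiff 𝓘(ℝ, EG) 𝓘(ℝ, V →L[ℝ] V) ∞ (fun g => ρ g))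
    (v : V) : ContMDiff 𝓘(ℝ, EG) 𝓘(ℝ, V) ∞ (fun g => ρ g⁻¹ v) :=
  (ContinuousLinearMap.apply ℝ V v).contMDiff.comp (contMDiff_rep_inv hρ)

variable [CompleteSpace V] in
/-- The derivative of `s : g ↦ ρ(g⁻¹) v` is `ξ ↦ -ω(ξ) · s(g)`, with `ω` the Maurer–Cartan form. -/
theorem hasMFDerivAt_rep_inv_apply
    (hρ : ContMDiff 𝓘(ℝ, EG) 𝓘(ℝ, V →L[ℝ] V) ∞ (fun g => ρ g)) (v : V) (g : G) :
    HasMFDerivAt 𝓘(ℝ, EG) 𝓘(ℝ, V) (fun g => ρ g⁻¹ v) g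
      (-((ContinuousLinearMap.apply ℝ V (ρ g⁻¹ v)).comp (infRep (EG := EG) ρ)).comp
        (maurerCartan g)) := by
  have h1 : HasMFDerivAt 𝓘(ℝ, V →L[ℝ] V) 𝓘(ℝ, V) (ContinuousLinearMap.apply ℝ V (ρ g⁻¹ v))
      (ρ (1 : G)⁻¹) (ContinuousLinearMap.apply ℝ V (ρ g⁻¹ v)) :=
    (ContinuousLinearMap.apply ℝ V (ρ g⁻¹ v)).hasMFDerivAt
  have h2 := HasMFDerivAt.comp (1 : G) h1 (hasMFDerivAt_rep_inv hρ)
  have h3 : HasMFDerivAt 𝓘(ℝ, EG) 𝓘(ℝ, V) (fun k : G => ρ k⁻¹ (ρ g⁻¹ v)) (g⁻¹ * g)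
      ((ContinuousLinearMap.apply ℝ V (ρ g⁻¹ v)).comp (-(infRep (EG := EG) ρ))) := by
    rw [inv_mul_cancel]
    exact h2
  have h4 := HasMFDerivAt.comp g h3 (hasMFDerivAt_maurerCartan g)
  have h5 : ((fun k : G => ρ k⁻¹ (ρ g⁻¹ v)) ∘ fun h : G => g⁻¹ * h) = fun g => ρ g⁻¹ v := by
    ext1 h
    simp only [Function.comp, rep_apply_apply]
    simp
  rw [h5] at h4
  refine h4.congr_mfderiv ?_
  ext ξ
  rfl

/-- `ρ(g)` intertwines the infinitesimal actions of `Ad(g⁻¹) Y` and `Y`; consequently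
`𝔤 · ρ(g) v = ρ(g) (𝔤 · v)`. -/
theorem infRep_rep_apply (hρ : ContMDiff 𝓘(ℝ, EG) 𝓘(ℝ, V →L[ℝ] V) ∞ (fun g => ρ g))
    (g : G) (Y : GroupLieAlgebra 𝓘(ℝ, EG) G) (v : V) :
    infRep (EG := EG) ρ Y (ρ g v) = ρ g (infRep (EG := EG) ρ (Ad (EG := EG) g⁻¹ Y) v) := by
  have h1 : HasMFDerivAt 𝓘(ℝ, EG) 𝓘(ℝ, V →L[ℝ] V) (fun g => ρ g) (g⁻¹ * 1 * g⁻¹⁻¹)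
      (infRep (EG := EG) ρ) := by
    have : g⁻¹ * 1 * g⁻¹⁻¹ = 1 := by group
    rw [this]
    exact hasMFDerivAt_infRep hρ
  have h2 := HasMFDerivAt.comp (1 : G) h1 (hasMFDerivAt_Ad (EG := EG) g⁻¹)
  have h3 := HasMFDerivAt.comp (1 : G)
    ((ρ g).comp (ContinuousLinearMap.apply ℝ V v)).hasMFDerivAt h2
  have h4 := HasMFDerivAt.comp (1 : G)
    (ContinuousLinearMap.apply ℝ V (ρ g v)).hasMFDerivAt (hasMFDerivAt_infRep hρ)
  have h5 : (⇑((ρ g).comp (ContinuousLinearMap.apply ℝ V v)) ∘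
      (fun g => ρ g) ∘ fun h : G => g⁻¹ * h * g⁻¹⁻¹) =
      (⇑(ContinuousLinearMap.apply ℝ V (ρ g v)) ∘ fun g : G => ρ g) := by
    ext1 h
    simp only [Function.comp, ContinuousLinearMap.apply_apply, ContinuousLinearMap.comp_apply,
      rep_apply_apply]
    simp [mul_assoc]
  rw [h5] at h3
  exact DFunLike.congr_fun (hasMFDerivAt_unique h4 h3) Y

end Representations

end BGG

/-! ### Local bounds for families of linear maps, and derivatives of charts -/

section Bound

open Set Filter Topology

variable {E : Type*} [NormedAddCommGroup E] [NormedSpace ℝ E]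
  {W : Type*} [NormedAddCommGroup W] [NormedSpace ℝ W]

/-- A family of linear maps that is jointly continuous at `(z₀, 0)` is bounded near `z₀`. -/
theorem exists_eventually_norm_le_of_continuousAt {A : E → E →L[ℝ] W} {z₀ : E}
    (hA : ContinuousAt (fun p : E × E => A p.1 p.2) (z₀, 0)) :
    ∃ C : ℝ, ∀ᶠ z in 𝓝 z₀, ∀ ξ, ‖A z ξ‖ ≤ C * ‖ξ‖ := by
  have h : ∀ᶠ p in 𝓝 (z₀, (0 : E)), ‖A p.1 p.2‖ < 1 := by
    refine hA.norm.eventually_lt continuousAt_const ?_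
    simp
  rw [nhds_prod_eq] at h
  obtain ⟨pa, hpa, pb, hpb, hab⟩ := eventually_prod_iff.1 h
  obtain ⟨δ, hδ, hball⟩ := Metric.eventually_nhds_iff_ball.1 hpb
  refine ⟨1 / (δ / 2), hpa.mono fun z hz ξ => ?_⟩
  have hle : ‖A z‖ ≤ 1 / (δ / 2) := by
    refine ContinuousLinearMap.opNorm_le_bound _ (by positivity) fun x => ?_
    rcases eq_or_ne x 0 with rfl | hx
    · simp
    have hx' : 0 < ‖x‖ := norm_pos_iff.2 hx
    have hmem : (δ / 2 / ‖x‖) • x ∈ Metric.ball (0 : E) δ := by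
      rw [mem_ball_zero_iff, norm_smul, Real.norm_of_nonneg (by positivity)]
      field_simp
      linarith
    have h1 := (hab hz (hball _ hmem)).le
    simp only [map_smul, norm_smul] at h1
    rw [Real.norm_of_nonneg (by positivity)] at h1
    have h2 : ‖A z x‖ = (δ / 2 / ‖x‖ * ‖A z x‖) * (1 / (δ / 2) * ‖x‖) := by
      field_simp
    rw [h2]
    exact mul_le_of_le_one_left (by positivity) h1
  exact (A z).le_of_opNorm_le hle ξ

end Bound

section ChartDerivative

open Set Filter Topology

variable {E : Type*} [NormedAddCommGroup E] [NormedSpace ℝ E]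
  {M : Type*} [TopologicalSpace M] [ChartedSpace E M]

theorem hasMFDerivAt_chartAt_self (x : M) :
    HasMFDerivAt 𝓘(ℝ, E) 𝓘(ℝ, E) (chartAt E x) x (ContinuousLinearMap.id ℝ E) := by
  refine ⟨(chartAt E x).continuousAt (mem_chart_source E x), ?_⟩
  simp only [writtenInExtChartAt, mfld_simps]
  refine HasFDerivAt.hasFDerivWithinAt ?_
  refine (hasFDerivAt_id _).congr_of_eventuallyEq ?_
  filter_upwards [(chartAt E x).open_target.mem_nhds (mem_chart_target E x)] with z hz
  simp [hz, chartAt_self_eq]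

end ChartDerivative

namespace BGG

open Set Filter Topology

/-! ### Local lifts of parallel sections to the group -/

section LocalLift

variable {EG : Type*} [NormedAddCommGroup EG] [NormedSpace ℝ EG]
  {G : Type*} [TopologicalSpace G] [ChartedSpace EG G] [Group G]
  {P : Subgroup G}
  {EB : Type*} [NormedAddCommGroup EB] [NormedSpace ℝ EB]
  {B : Type*} [TopologicalSpace B] [ChartedSpace EB B]
  {M : Type*}
  {V : Type*} [NormedAddCommGroup V] [NormedSpace ℝ V]
  {E : Type*} [NormedAddCommGroup E] [NormedSpace ℝ E]
  {C : CartanData EG P EB B M} {ρ : G →* (V →L[ℝ] V)}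

/-- The pull-back `ξ ↦ ω(dτ ξ)` at `z` of the form `ω` of `C` along `τ`, acting on `V` by the
infinitesimal representation. -/
noncomputable def pullbackAction (C : CartanData EG P EB B M) (ρ : G →* (V →L[ℝ] V)) (τ : E → B)
    (z : E) : E →L[ℝ] (V →L[ℝ] V) :=
  (infRep (EG := EG) ρ).comp ((C.form (τ z)).comp (mfderiv 𝓘(ℝ, E) 𝓘(ℝ, EB) τ z))

theorem exists_eventually_norm_pullbackAction_le [IsManifold 𝓘(ℝ, EB) ∞ B]
    (hform : ContMDiff 𝓘(ℝ, EB).tangent 𝓘(ℝ, EG) ∞ C.formMap) {τ : E → B} {z₀ : E}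
    (hτ : ∀ᶠ z in 𝓝 z₀, ContMDiffAt 𝓘(ℝ, E) 𝓘(ℝ, EB) ∞ τ z) :
    ∃ K : ℝ, ∀ᶠ z in 𝓝 z₀, ∀ ξ, ‖pullbackAction C ρ τ z ξ‖ ≤ K * ‖ξ‖ := by
  apply exists_eventually_norm_le_of_continuousAt
  have : IsManifold 𝓘(ℝ, EB) 1 B := IsManifold.of_le (n := ∞) (by simp)
  obtain ⟨U, hU, hUo, hz₀⟩ := eventually_nhds_iff.1 hτ
  have h1 : ContMDiffOn 𝓘(ℝ, E) 𝓘(ℝ, EB) ∞ τ U := fun z hz => (hU z hz).contMDiffWithinAt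
  have h2 := h1.continuousOn_tangentMapWithin (by simp) hUo.uniqueMDiffOn
  have h3 : ContinuousAt (tangentMapWithin 𝓘(ℝ, E) 𝓘(ℝ, EB) τ U)
      ((tangentBundleModelSpaceHomeomorph 𝓘(ℝ, E)).symm (z₀, 0)) := by
    refine h2.continuousAt ((hUo.preimage ?_).mem_nhds hz₀)
    exact FiberBundle.continuous_proj E (TangentSpace 𝓘(ℝ, E))
  have h4 : ContinuousAt (fun p : E × E => C.formMap (tangentMapWithin 𝓘(ℝ, E) 𝓘(ℝ, EB) τ U
      ((tangentBundleModelSpaceHomeomorph 𝓘(ℝ, E)).symm p))) (z₀, 0) :=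
    hform.continuous.continuousAt.comp
      (h3.comp (tangentBundleModelSpaceHomeomorph 𝓘(ℝ, E)).symm.continuous.continuousAt)
  have h5 : ContinuousAt (fun p : E × E => infRep (EG := EG) ρ (C.formMap
      (tangentMapWithin 𝓘(ℝ, E) 𝓘(ℝ, EB) τ U
        ((tangentBundleModelSpaceHomeomorph 𝓘(ℝ, E)).symm p)))) (z₀, 0) :=
    (infRep (EG := EG) ρ).continuous.continuousAt.comp h4
  refine h5.congr ?_
  filter_upwards [(hUo.preimage continuous_fst).mem_nhds (x := (z₀, (0 : E))) hz₀] with p hp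
  have h6 : mfderivWithin 𝓘(ℝ, E) 𝓘(ℝ, EB) τ U p.1 = mfderiv 𝓘(ℝ, E) 𝓘(ℝ, EB) τ p.1 :=
    mfderivWithin_of_isOpen hUo hp
  change infRep (EG := EG) ρ (C.form (τ p.1) (mfderivWithin 𝓘(ℝ, E) 𝓘(ℝ, EB) τ U p.1 p.2)) = _
  rw [h6]
  rfl

theorem IsParallelSection.hasFDerivAt_comp {s : B → V} (hs : IsParallelSection C ρ s) {τ : E → B}
    {z : E} (hτ : MDifferentiableAt 𝓘(ℝ, E) 𝓘(ℝ, EB) τ z) :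
    HasFDerivAt (s ∘ τ)
      (-(ContinuousLinearMap.apply ℝ V (s (τ z))).comp (pullbackAction C ρ τ z)) z := by
  have h1 : HasMFDerivAt 𝓘(ℝ, EB) 𝓘(ℝ, V) s (τ z) (diff s (τ z)) :=
    ((hs.contMDiff (τ z)).mdifferentiableAt (by simp)).hasMFDerivAt
  have h2 := (HasMFDerivAt.comp z h1 hτ.hasMFDerivAt).hasFDerivAt
  refine h2.congr_fderiv ?_
  ext ξ
  exact eq_neg_of_add_eq_zero_left (hs.parallel (τ z) _)

variable [IsManifold 𝓘(ℝ, EB) ∞ B] [FiniteDimensional ℝ EG] [FiniteDimensional ℝ V]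
  [LieGroup 𝓘(ℝ, EG) ∞ G]

/-- Along a smooth map `τ` into the total space, a parallel section `s` agrees near `z₀` with the
parallel section `h ↦ ρ(h⁻¹) s(τ z₀)` of the model along a smooth map `g` into `G`, which can be
chosen with `ω ∘ dτ` as derivative at `z₀`. -/
theorem exists_local_lift (hρ : ContMDiff 𝓘(ℝ, EG) 𝓘(ℝ, V →L[ℝ] V) ∞ (fun g => ρ g))
    (hform : ContMDiff 𝓘(ℝ, EB).tangent 𝓘(ℝ, EG) ∞ C.formMap)
    {s : B → V} (hs : IsParallelSection C ρ s) {τ : E → B} {z₀ : E}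
    (hτ : ∀ᶠ z in 𝓝 z₀, ContMDiffAt 𝓘(ℝ, E) 𝓘(ℝ, EB) ∞ τ z) :
    ∃ g : E → G, g z₀ = 1 ∧ (∀ᶠ z in 𝓝 z₀, ContMDiffAt 𝓘(ℝ, E) 𝓘(ℝ, EG) ∞ g z) ∧
      HasMFDerivAt 𝓘(ℝ, E) 𝓘(ℝ, EG) g z₀
        ((C.form (τ z₀)).comp (mfderiv 𝓘(ℝ, E) 𝓘(ℝ, EB) τ z₀)) ∧
      ∀ᶠ z in 𝓝 z₀, s (τ z) = ρ (g z)⁻¹ (s (τ z₀)) := by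
  -- `L` is the derivative of the orbit map of `v₀`, and `a = L ∘ r` is a projection onto `𝔤 · v₀`.
  set v₀ : V := s (τ z₀) with hv₀
  let L : EG →L[ℝ] V := (ContinuousLinearMap.apply ℝ V v₀).comp (infRep (EG := EG) ρ)
  have hL : ∀ Y : GroupLieAlgebra 𝓘(ℝ, EG) G, infRep (EG := EG) ρ Y v₀ = L Y := fun Y => rfl
  obtain ⟨r, hr⟩ := exists_generalized_inverse L
  let a : V →L[ℝ] V := L.comp r
  have haL : ∀ Y, a (L Y) = L Y := hr
  let Ω : E →L[ℝ] EG := (C.form (τ z₀)).comp (mfderiv 𝓘(ℝ, E) 𝓘(ℝ, EB) τ z₀)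
  have hcompl : CompleteSpace V := FiniteDimensional.complete ℝ V
  -- `Q` has its range in the kernel of `L`, so that `L ∘ κ` depends on the model section alone. The
  -- second term of `κ` makes up for the loss: the derivative of `κ` at `1` is the identity.
  let c := chartAt EG (1 : G)
  have hmodel : ContMDiff 𝓘(ℝ, EG) 𝓘(ℝ, V) ∞ (fun g : G => ρ g⁻¹ v₀) :=
    contMDiff_rep_inv_apply hρ v₀
  let Q : EG →L[ℝ] EG := ContinuousLinearMap.id ℝ EG - r.comp L
  let κ : G → EG := fun g => Q (c g) - r (ρ g⁻¹ v₀)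
  have hκ : ∀ᶠ g in 𝓝 (1 : G), ContMDiffAt 𝓘(ℝ, EG) 𝓘(ℝ, EG) ∞ κ g := by
    filter_upwards [c.open_source.mem_nhds (mem_chart_source EG (1 : G))] with g hg
    have h1 : ContMDiffAt 𝓘(ℝ, EG) 𝓘(ℝ, EG) ∞ c g :=
      contMDiffOn_chart.contMDiffAt (c.open_source.mem_nhds hg)
    exact (Q.contMDiff.contMDiffAt.comp g h1).sub (r.contMDiff.contMDiffAt.comp g (hmodel g))
  have hQ : ∀ X, Q X = X - r (L X) := fun X => rfl
  have hQL : ∀ X, Q X - r (-(L X)) = X := fun X => by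
    rw [hQ, map_neg, sub_neg_eq_add, sub_add_cancel]
  have hκ' : HasMFDerivAt 𝓘(ℝ, EG) 𝓘(ℝ, EG) κ 1 (ContinuousLinearMap.id ℝ EG) := by
    have h1 := HasMFDerivAt.comp (1 : G) Q.hasMFDerivAt (hasMFDerivAt_chartAt_self (1 : G))
    have h2 := HasMFDerivAt.comp (1 : G) r.hasMFDerivAt (hasMFDerivAt_rep_inv_apply hρ v₀ (1 : G))
    refine (h1.sub h2).congr_mfderiv ?_
    ext η
    change Q η - r (-(infRep (EG := EG) ρ (maurerCartan 1 η) (ρ (1 : G)⁻¹ v₀))) = η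
    rw [inv_one, map_one, maurerCartan_one]
    exact hQL η
  obtain ⟨Φ, hΦ1, hΦκ, -, hΦs⟩ :=
    exists_local_diffeomorphism hκ hκ' Function.bijective_id
  -- `b` is the analogue of `κ` for `s ∘ τ`; solving `κ(g) = b` matches the projections of the two
  -- sections under `a`, and gives `g` the same derivative as `β` at `z₀`.
  let β : E → EG := fun z => c 1 + (Ω z - Ω z₀)
  let b : E → EG := fun z => Q (β z) - r (s (τ z))
  have hb₀ : b z₀ = Φ 1 := by
    rw [hΦκ hΦ1]
    simp [b, β, κ, ← hv₀]
  have hτ₀ := hτ.self_of_nhds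
  have hbsm : ∀ᶠ z in 𝓝 z₀, ContMDiffAt 𝓘(ℝ, E) 𝓘(ℝ, EG) ∞ b z := by
    filter_upwards [hτ] with z hz
    have h1 : ContDiff ℝ ∞ β := by fun_prop
    exact (Q.contMDiff.contMDiffAt.comp z h1.contMDiff.contMDiffAt).sub
      (r.contMDiff.contMDiffAt.comp z ((hs.contMDiff (τ z)).comp z hz))
  have hb' : HasFDerivAt b Ω z₀ := by
    have h1 : HasFDerivAt β Ω z₀ := by
      exact (Ω.hasFDerivAt.sub_const (Ω z₀)).const_add (c 1)
    have h2 := Q.hasFDerivAt.comp z₀ h1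
    have h3 := r.hasFDerivAt.comp z₀
      (hs.hasFDerivAt_comp (hτ₀.mdifferentiableAt (by simp)))
    refine (h2.sub h3).congr_fderiv ?_
    ext ξ
    exact hQL (Ω ξ)
  let g : E → G := fun z => Φ.symm (b z)
  have hg₀ : g z₀ = 1 := by
    simp only [g, hb₀]
    exact Φ.left_inv hΦ1
  have hbt : ∀ᶠ z in 𝓝 z₀, b z ∈ Φ.target := by
    refine hb'.continuousAt.eventually_mem (Φ.open_target.mem_nhds ?_)
    rw [hb₀]
    exact Φ.map_source hΦ1
  have hgsm : ∀ᶠ z in 𝓝 z₀, ContMDiffAt 𝓘(ℝ, E) 𝓘(ℝ, EG) ∞ g z := by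
    filter_upwards [hbt, hbsm] with z hz hz'
    exact (hΦs.contMDiffAt (Φ.open_target.mem_nhds hz)).comp z hz'
  have hκg : ∀ᶠ z in 𝓝 z₀, κ (g z) = b z := by
    filter_upwards [hbt] with z hz
    rw [← hΦκ (Φ.map_target hz)]
    exact Φ.right_inv hz
  have hgd := (hgsm.self_of_nhds.mdifferentiableAt (by simp)).hasMFDerivAt
  have hg' : HasMFDerivAt 𝓘(ℝ, E) 𝓘(ℝ, EG) g z₀ Ω := by
    refine hgd.congr_mfderiv ?_
    have h1 : HasMFDerivAt 𝓘(ℝ, EG) 𝓘(ℝ, EG) κ (g z₀) (ContinuousLinearMap.id ℝ EG) := by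
      rw [hg₀]
      exact hκ'
    let g' : E →L[ℝ] EG := mfderiv 𝓘(ℝ, E) 𝓘(ℝ, EG) g z₀
    have h2 : HasFDerivAt (κ ∘ g) g' z₀ := (HasMFDerivAt.comp z₀ h1 hgd).hasFDerivAt
    have h3 : HasFDerivAt (κ ∘ g) Ω z₀ := hb'.congr_of_eventuallyEq hκg
    exact h2.unique h3
  refine ⟨g, hg₀, hgsm, hg', ?_⟩
  let D : E → V := fun z => s (τ z) - ρ (g z)⁻¹ v₀
  have haD : ∀ᶠ z in 𝓝 z₀, a (D z) = 0 := by
    filter_upwards [hκg] with z hz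
    have hLQ : ∀ X, L (Q X) = 0 := fun X => by rw [hQ, map_sub, hr, sub_self]
    have h1 := congrArg L hz
    simp only [κ, b, map_sub, hLQ, zero_sub, neg_inj] at h1
    simp only [D, map_sub]
    exact sub_eq_zero.2 h1.symm
  -- The error term `Y ξ · ρ(g⁻¹) v₀` has no bound in terms of `D` by itself; it is controlled by its
  -- image under `a`, which is determined by `a(dD) = 0`.
  have hD' : ∀ᶠ z in 𝓝 z₀, ∃ Y : E → GroupLieAlgebra 𝓘(ℝ, EG) G, ∃ D' : E →L[ℝ] V,
      HasFDerivAt D D' z ∧ ∀ ξ, D' ξ =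
        -(pullbackAction C ρ τ z ξ (D z)) + infRep (EG := EG) ρ (Y ξ) (ρ (g z)⁻¹ v₀) := by
    filter_upwards [hτ, hgsm] with z hz hgz
    have h1 := hs.hasFDerivAt_comp (hz.mdifferentiableAt (by simp))
    have h2 := (HasMFDerivAt.comp z (hasMFDerivAt_rep_inv_apply hρ v₀ (g z))
      (hgz.mdifferentiableAt (by simp)).hasMFDerivAt).hasFDerivAt
    refine ⟨fun ξ => maurerCartan (g z) (mfderiv 𝓘(ℝ, E) 𝓘(ℝ, EG) g z ξ) -
      C.form (τ z) (mfderiv 𝓘(ℝ, E) 𝓘(ℝ, EB) τ z ξ), _, h1.sub h2, fun ξ => ?_⟩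
    change -(pullbackAction C ρ τ z ξ (s (τ z))) - -(infRep (EG := EG) ρ
      (maurerCartan (g z) (mfderiv 𝓘(ℝ, E) 𝓘(ℝ, EG) g z ξ)) (ρ (g z)⁻¹ v₀)) = _
    simp only [D, map_sub, sub_apply]
    change _ = _ + (_ - pullbackAction C ρ τ z ξ (ρ (g z)⁻¹ v₀))
    abel
  have hK : ∀ᶠ z in 𝓝 z₀, ∀ Y : GroupLieAlgebra 𝓘(ℝ, EG) G,
      ‖infRep (EG := EG) ρ Y (ρ (g z)⁻¹ v₀)‖ ≤
        4 * ‖a (infRep (EG := EG) ρ Y (ρ (g z)⁻¹ v₀))‖ := by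
    have hR : ContinuousAt (fun z => ρ (g z)⁻¹) z₀ :=
      (contMDiff_rep_inv hρ).continuous.continuousAt.comp hgsm.self_of_nhds.continuousAt
    have h1 : ∀ᶠ z in 𝓝 z₀, ‖a‖ * ‖ρ (g z)⁻¹ - 1‖ < 1 / 2 := by
      refine (continuousAt_const.mul (hR.sub continuousAt_const).norm).eventually_lt
        continuousAt_const ?_
      simp [hg₀]
    have h2 : ∀ᶠ z in 𝓝 z₀, ‖ρ (g z)⁻¹‖ < 2 := by
      refine hR.norm.eventually_lt continuousAt_const ?_
      rw [hg₀, inv_one, map_one]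
      exact ContinuousLinearMap.norm_id_le.trans_lt one_lt_two
    filter_upwards [h1, h2] with z hz1 hz2 Y
    rw [infRep_rep_apply hρ]
    refine (norm_le_of_norm_sub_one_le hz1.le (haL _)).trans ?_
    exact mul_le_mul_of_nonneg_right (by linarith) (norm_nonneg _)
  obtain ⟨K, hA⟩ := exists_eventually_norm_pullbackAction_le (ρ := ρ) hform hτ
  have hzero : ∀ᶠ z in 𝓝 z₀, D z = 0 := by
    refine eventually_eq_zero_of_norm_fderiv_le (C := (1 + 4 * ‖a‖) * K)
      (hD'.mono fun z ⟨Y, D', h, _⟩ => h.differentiableAt) ?_ ?_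
    · filter_upwards [hD', hK, hA, haD.eventually_nhds] with z ⟨Y, D', hDz, hDY⟩ hKz hAz haz ξ
      rw [hDz.fderiv, hDY]
      have h0 : a (D' ξ) = 0 := by
        have h1 := a.hasFDerivAt.comp z hDz
        have h2 : HasFDerivAt (a ∘ D) (0 : E →L[ℝ] V) z :=
          (hasFDerivAt_const (0 : V) z).congr_of_eventuallyEq haz
        exact DFunLike.congr_fun (h1.unique h2) ξ
      rw [hDY, map_add, map_neg, neg_add_eq_zero] at h0
      have h3 : ‖pullbackAction C ρ τ z ξ (D z)‖ ≤ K * ‖ξ‖ * ‖D z‖ :=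
        ContinuousLinearMap.le_of_opNorm_le _ (hAz ξ) _
      calc _ ≤ ‖pullbackAction C ρ τ z ξ (D z)‖ +
            4 * ‖a (pullbackAction C ρ τ z ξ (D z))‖ := by
            refine (norm_add_le _ _).trans ?_
            rw [norm_neg, h0]
            gcongr
            exact hKz _
        _ ≤ ‖pullbackAction C ρ τ z ξ (D z)‖ +
            4 * (‖a‖ * ‖pullbackAction C ρ τ z ξ (D z)‖) := by
            gcongr
            exact a.le_opNorm _
        _ = (1 + 4 * ‖a‖) * ‖pullbackAction C ρ τ z ξ (D z)‖ := by ring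
        _ ≤ (1 + 4 * ‖a‖) * (K * ‖ξ‖ * ‖D z‖) := by gcongr
        _ = _ := by ring
    · simp [D, hg₀, ← hv₀]
  exact hzero.mono fun z hz => sub_eq_zero.1 hz

end LocalLift

end BGG

/-! ### Fibres of submersions -/

section Submersion

open Set Filter Topology

variable {E : Type*} [NormedAddCommGroup E] [NormedSpace ℝ E]
  {F : Type*} [NormedAddCommGroup F] [NormedSpace ℝ F]
  {M : Type*} [TopologicalSpace M] [ChartedSpace E M]
  {N : Type*} [TopologicalSpace N] [ChartedSpace F N]

theorem mdifferentiable_of_mem_maximalAtlas {φ : OpenPartialHomeomorph M E}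
    (hφ : φ ∈ IsManifold.maximalAtlas 𝓘(ℝ, E) ∞ M) : φ.MDifferentiable 𝓘(ℝ, E) 𝓘(ℝ, E) :=
  ⟨(contMDiffOn_of_mem_maximalAtlas hφ).mdifferentiableOn (by simp),
    (contMDiffOn_symm_of_mem_maximalAtlas hφ).mdifferentiableOn (by simp)⟩

theorem mfderiv_bijective_of_mem_maximalAtlas {φ : OpenPartialHomeomorph M E}
    (hφ : φ ∈ IsManifold.maximalAtlas 𝓘(ℝ, E) ∞ M) {x : M} (hx : x ∈ φ.source) :
    Function.Bijective (mfderiv 𝓘(ℝ, E) 𝓘(ℝ, E) φ x) :=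
  (mdifferentiable_of_mem_maximalAtlas hφ).mfderiv_bijective hx

theorem Manifold.IsSubmersionAt.codChart_apply_symm {f : M → N} {x : M}
    (h : Manifold.IsSubmersionAt 𝓘(ℝ, E) 𝓘(ℝ, F) ∞ f x) {z : E} (hz : z ∈ h.domChart.target) :
    h.codChart (f (h.domChart.symm z)) = (h.equiv z).1 := by
  have := h.writtenInCharts
    (show z ∈ (h.domChart.extend 𝓘(ℝ, E)).target by simpa using hz)
  simpa [OpenPartialHomeomorph.extend] using this

/-- In the charts of a submersion, its derivative is the projection onto a factor. -/
theorem Manifold.IsSubmersionAt.mfderiv_codChart {f : M → N} {x : M}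
    (h : Manifold.IsSubmersionAt 𝓘(ℝ, E) 𝓘(ℝ, F) ∞ f x) (η : TangentSpace 𝓘(ℝ, E) x) :
    mfderiv 𝓘(ℝ, F) 𝓘(ℝ, F) h.codChart (f x) (mfderiv 𝓘(ℝ, E) 𝓘(ℝ, F) f x η) =
      (h.equiv (mfderiv 𝓘(ℝ, E) 𝓘(ℝ, E) h.domChart x η)).1 := by
  have h1 := ((mdifferentiable_of_mem_maximalAtlas h.codChart_mem_maximalAtlas).mdifferentiableAt
    h.mem_codChart_source).hasMFDerivAt
  have h2 := ((mdifferentiable_of_mem_maximalAtlas h.domChart_mem_maximalAtlas).mdifferentiableAt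
    h.mem_domChart_source).hasMFDerivAt
  have h3 := (h.contMDiffAt.mdifferentiableAt (by simp)).hasMFDerivAt
  have h4 := HasMFDerivAt.comp x h1 h3
  let p : E →L[ℝ] F := (ContinuousLinearMap.fst ℝ F h.complement).comp
    (h.equiv : E →L[ℝ] F × h.complement)
  have h5 := HasMFDerivAt.comp x (p.hasMFDerivAt (x := h.domChart x)) h2
  have h6 : h.codChart ∘ f =ᶠ[𝓝 x] p ∘ h.domChart := by
    filter_upwards [h.domChart.open_source.mem_nhds h.mem_domChart_source] with y hy
    simpa [p, h.domChart.left_inv hy] using h.codChart_apply_symm (h.domChart.map_source hy)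
  exact DFunLike.congr_fun (hasMFDerivAt_unique h4 (h5.congr_of_eventuallyEq h6)) η

theorem Manifold.IsSubmersionAt.mfderiv_surjective {f : M → N} {x : M}
    (h : Manifold.IsSubmersionAt 𝓘(ℝ, E) 𝓘(ℝ, F) ∞ f x) :
    Function.Surjective (mfderiv 𝓘(ℝ, E) 𝓘(ℝ, F) f x) := by
  intro q
  obtain ⟨η, hη⟩ := (mfderiv_bijective_of_mem_maximalAtlas h.domChart_mem_maximalAtlas
    h.mem_domChart_source).2
    (h.equiv.symm (mfderiv 𝓘(ℝ, F) 𝓘(ℝ, F) h.codChart (f x) q, 0))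
  refine ⟨η, (mfderiv_bijective_of_mem_maximalAtlas h.codChart_mem_maximalAtlas
    h.mem_codChart_source).1 ?_⟩
  rw [h.mfderiv_codChart, hη]
  exact congrArg Prod.fst (h.equiv.apply_symm_apply _)

/-- A vector in the kernel of the derivative of a submersion is tangent to a curve in the fibre,
namely a straight line in the charts of the submersion. -/
theorem Manifold.IsSubmersionAt.exists_curve {f : M → N} {x : M}
    (h : Manifold.IsSubmersionAt 𝓘(ℝ, E) 𝓘(ℝ, F) ∞ f x) {η : TangentSpace 𝓘(ℝ, E) x}
    (hη : mfderiv 𝓘(ℝ, E) 𝓘(ℝ, F) f x η = 0) :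
    ∃ (γ : ℝ → M) (γ' : ℝ →L[ℝ] TangentSpace 𝓘(ℝ, E) x), γ 0 = x ∧
      ContMDiffAt 𝓘(ℝ, ℝ) 𝓘(ℝ, E) ∞ γ 0 ∧
      (∀ᶠ t in 𝓝 0, f (γ t) = f x) ∧ HasMFDerivAt 𝓘(ℝ, ℝ) 𝓘(ℝ, E) γ 0 γ' ∧ γ' 1 = η := by
  let d := h.domChart
  let w : E := mfderiv 𝓘(ℝ, E) 𝓘(ℝ, E) d x η
  have hw : (h.equiv w).1 = 0 := by
    rw [← h.mfderiv_codChart η, hη]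
    exact map_zero _
  have hdx : d x ∈ d.target := d.map_source h.mem_domChart_source
  let l : ℝ → E := fun t => d x + t • w
  have hl : ContDiff ℝ ∞ l := by fun_prop
  have hl0 : l 0 = d x := by simp [l]
  have hl' : HasFDerivAt l (ContinuousLinearMap.toSpanSingleton ℝ w) 0 := by
    have := ((ContinuousLinearMap.toSpanSingleton ℝ w).hasFDerivAt (x := 0)).const_add (d x)
    exact this
  have hsm := (contMDiffOn_symm_of_mem_maximalAtlas
    h.domChart_mem_maximalAtlas).contMDiffAt (d.open_target.mem_nhds hdx)
  have hsm' : ContMDiffAt 𝓘(ℝ, E) 𝓘(ℝ, E) ∞ d.symm (l 0) := by rw [hl0]; exact hsm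
  have hγ0 : d.symm (l 0) = x := by rw [hl0]; exact d.left_inv h.mem_domChart_source
  have hγsm : ContMDiffAt 𝓘(ℝ, ℝ) 𝓘(ℝ, E) ∞ (d.symm ∘ l) 0 :=
    hsm'.comp 0 hl.contMDiff.contMDiffAt
  have hγd := (hγsm.mdifferentiableAt (by simp)).hasMFDerivAt
  refine ⟨d.symm ∘ l, mfderiv 𝓘(ℝ, ℝ) 𝓘(ℝ, E) (d.symm ∘ l) 0, hγ0, hγsm, ?_, hγd, ?_⟩
  · have hlt : ∀ᶠ t in 𝓝 0, l t ∈ d.target :=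
      hl.continuous.continuousAt.eventually_mem (d.open_target.mem_nhds (by rw [hl0]; exact hdx))
    filter_upwards [hlt] with t ht
    refine h.codChart.injOn (h.source_subset_preimage_source (d.map_target ht))
      h.mem_codChart_source ?_
    have h1 := h.codChart_apply_symm ht
    have h2 := h.codChart_apply_symm hdx
    rw [d.left_inv h.mem_domChart_source] at h2
    rw [h2]
    change h.codChart (f (d.symm (l t))) = _
    rw [h1]
    simp [l, hw]
  · have h1 : HasMFDerivAt 𝓘(ℝ, E) 𝓘(ℝ, E) d (d.symm (l 0)) (mfderiv 𝓘(ℝ, E) 𝓘(ℝ, E) d x) := by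
      rw [hγ0]
      exact ((mdifferentiable_of_mem_maximalAtlas
        h.domChart_mem_maximalAtlas).mdifferentiableAt h.mem_domChart_source).hasMFDerivAt
    have h2 := HasMFDerivAt.comp (0 : ℝ) h1 hγd
    have h3 : l =ᶠ[𝓝 0] d ∘ (d.symm ∘ l) := by
      have hlt : ∀ᶠ t in 𝓝 0, l t ∈ d.target :=
        hl.continuous.continuousAt.eventually_mem
          (d.open_target.mem_nhds (by rw [hl0]; exact hdx))
      filter_upwards [hlt] with t ht
      exact (d.right_inv ht).symm
    have h4 := hasMFDerivAt_unique (h2.congr_of_eventuallyEq h3) hl'.hasMFDerivAt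
    have h5 := DFunLike.congr_fun h4 (1 : ℝ)
    refine (mfderiv_bijective_of_mem_maximalAtlas h.domChart_mem_maximalAtlas
      h.mem_domChart_source).1 ?_
    refine h5.trans ?_
    exact one_smul ℝ w

end Submersion

namespace BGG

open Set Filter Topology

/-! ### The kernel of the derivative of the projection to the homogeneous space -/

section Isotropy

variable {EG : Type*} [NormedAddCommGroup EG] [NormedSpace ℝ EG]
  {G : Type*} [TopologicalSpace G] [ChartedSpace EG G] [Group G]
  {EP : Type*} [NormedAddCommGroup EP] [NormedSpace ℝ EP]
  {P : Subgroup G} [ChartedSpace EP P]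
  {EQ : Type*} [NormedAddCommGroup EQ] [NormedSpace ℝ EQ] [ChartedSpace EQ (G ⧸ P)]

theorem hasMFDerivAt_inclDeriv (hP : IsClosedLieSubgroup (EG := EG) (EP := EP) P) :
    HasMFDerivAt 𝓘(ℝ, EP) 𝓘(ℝ, EG) (Subtype.val : P → G) 1 (inclDeriv (EG := EG) P) :=
  ((hP.isSmoothEmbedding.isImmersion.isImmersionAt 1).contMDiffAt.mdifferentiableAt
    (by simp)).hasMFDerivAt

theorem mfderiv_mk_inclDeriv (hP : IsClosedLieSubgroup (EG := EG) (EP := EP) P)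
    (hQ : Manifold.IsSubmersion 𝓘(ℝ, EG) 𝓘(ℝ, EQ) ∞ (fun g : G => (g : G ⧸ P)))
    (Y : GroupLieAlgebra 𝓘(ℝ, EP) P) :
    mfderiv 𝓘(ℝ, EG) 𝓘(ℝ, EQ) (fun g : G => (g : G ⧸ P)) 1 (inclDeriv (EG := EG) P Y) = 0 := by
  have h1 := ((hQ.isSubmersionAt 1).contMDiffAt.mdifferentiableAt (by simp)).hasMFDerivAt
  have h2 := HasMFDerivAt.comp (1 : P) h1 (hasMFDerivAt_inclDeriv hP)
  have h3 : (fun g : G => (g : G ⧸ P)) ∘ (Subtype.val : P → G) = fun _ => ((1 : G) : G ⧸ P) := by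
    ext1 p
    exact (QuotientGroup.eq (s := P)).2 (by simp)
  rw [h3] at h2
  exact DFunLike.congr_fun (hasMFDerivAt_unique h2 (hasMFDerivAt_const _ _)) Y

/-- The kernel of `T₁G → T(G/P)` is contained in the Lie algebra of `P`: a vector in the kernel is
tangent to a curve in `G` with values in `P`, which is smooth as a curve in `P` because `P` is
embedded. -/
theorem exists_inclDeriv_eq_of_mfderiv_mk_eq_zero
    (hP : IsClosedLieSubgroup (EG := EG) (EP := EP) P)
    (hQ : Manifold.IsSubmersion 𝓘(ℝ, EG) 𝓘(ℝ, EQ) ∞ (fun g : G => (g : G ⧸ P)))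
    {η : GroupLieAlgebra 𝓘(ℝ, EG) G}
    (hη : mfderiv 𝓘(ℝ, EG) 𝓘(ℝ, EQ) (fun g : G => (g : G ⧸ P)) 1 η = 0) :
    ∃ Y : GroupLieAlgebra 𝓘(ℝ, EP) P, inclDeriv (EG := EG) P Y = η := by
  obtain ⟨γ, γ', hγ0, hγs, hγf, hγ', rfl⟩ := (hQ.isSubmersionAt 1).exists_curve hη
  have hmem : ∀ᶠ t in 𝓝 0, γ t ∈ P := by
    filter_upwards [hγf] with t ht
    have := (QuotientGroup.eq (s := P)).1 ht.symm
    simpa using this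
  classical
  let δ : ℝ → P := fun t => if h : γ t ∈ P then ⟨γ t, h⟩ else 1
  have hδ : Subtype.val ∘ δ =ᶠ[𝓝 0] γ := by
    filter_upwards [hmem] with t ht
    simp [δ, ht]
  have hδ0 : δ 0 = 1 := Subtype.ext (by simpa [hγ0] using hδ.self_of_nhds)
  have hδs : ContMDiffAt 𝓘(ℝ, ℝ) 𝓘(ℝ, EP) ∞ δ 0 := by
    rw [ContMDiffAt.iff_comp_isImmersionAt
      (hP.isSmoothEmbedding.isImmersion.isImmersionAt (δ 0))]
    have h1 : ContMDiffAt 𝓘(ℝ, ℝ) 𝓘(ℝ, EG) ∞ (Subtype.val ∘ δ) 0 :=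
      hγs.congr_of_eventuallyEq hδ
    exact ⟨(hP.isSmoothEmbedding.isEmbedding.continuousAt_iff).2 h1.continuousAt, h1⟩
  have hδd := (hδs.mdifferentiableAt (by simp)).hasMFDerivAt
  have h1 : HasMFDerivAt 𝓘(ℝ, EP) 𝓘(ℝ, EG) (Subtype.val : P → G) (δ 0)
      (inclDeriv (EG := EG) P) := by
    rw [hδ0]
    exact hasMFDerivAt_inclDeriv hP
  have h2 := HasMFDerivAt.comp (0 : ℝ) h1 hδd
  have h3 := hasMFDerivAt_unique h2 (hγ'.congr_of_eventuallyEq hδ)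
  exact ⟨mfderiv 𝓘(ℝ, ℝ) 𝓘(ℝ, EP) δ 0 (1 : ℝ), DFunLike.congr_fun h3 (1 : ℝ)⟩

end Isotropy

/-! ### Normal solutions on the homogeneous model -/

section Model

variable {EG : Type*} [NormedAddCommGroup EG] [NormedSpace ℝ EG]
  {G : Type*} [TopologicalSpace G] [ChartedSpace EG G] [Group G] [LieGroup 𝓘(ℝ, EG) ∞ G]
  {EP : Type*} [NormedAddCommGroup EP] [NormedSpace ℝ EP]
  {P : Subgroup G} [ChartedSpace EP P]
  {EQ : Type*} [NormedAddCommGroup EQ] [NormedSpace ℝ EQ] [ChartedSpace EQ (G ⧸ P)]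
  {V : Type*} [NormedAddCommGroup V] [NormedSpace ℝ V]
  {ρ : G →* (V →L[ℝ] V)}

theorem isParallelSection_homogeneousModel [CompleteSpace V]
    (hρ : ContMDiff 𝓘(ℝ, EG) 𝓘(ℝ, V →L[ℝ] V) ∞ (fun g => ρ g)) (v : V) :
    IsParallelSection (homogeneousModel EG P) ρ (fun g : G => ρ g⁻¹ v) where
  contMDiff := contMDiff_rep_inv_apply hρ v
  equivariant g p := by
    change ρ (g * p)⁻¹ v = ρ (p : G)⁻¹ (ρ g⁻¹ v)
    rw [rep_apply_apply, mul_inv_rev]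
  parallel g ξ := by
    rw [tractorDeriv, diff, (hasMFDerivAt_rep_inv_apply hρ v g).mfderiv]
    exact neg_add_cancel _

variable [CompleteSpace EG]

/-- A parallel section `s` is the image of its projection under the splitting operator, and the
projection is a solution: as `∇ s = 0`, the representative `φ = 0` serves for both conditions. -/
theorem IsParallelSection.isBGGSolution {EB : Type*} [NormedAddCommGroup EB] [NormedSpace ℝ EB]
    {B : Type*} [TopologicalSpace B] [ChartedSpace EB B] {M : Type*}
    {C : CartanData EG P EB B M} (Γ : ParabolicGrading (EG := EG) (EP := EP) P)
    {s : B → V} (hs : IsParallelSection C ρ s) :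
    IsBGGSolution C Γ ρ (fun u => (filtTop Γ ρ).mkQ (s u)) := by
  refine ⟨s, ⟨hs.toIsTractorSection, fun u => rfl, fun u => ⟨0, ⟨0, 0, 0, ?_, ?_, ?_⟩,
    hs.parallel u⟩⟩, fun u => ⟨0, zero_mem _, hs.parallel u⟩⟩
  · simp
  · simp
  · simp

variable [CompleteSpace V]

/-- The normal solution on the homogeneous model given by `s(g) = ρ(g⁻¹) v`. -/
noncomputable def modelSolution (Γ : ParabolicGrading (EG := EG) (EP := EP) P)
    (hρ : ContMDiff 𝓘(ℝ, EG) 𝓘(ℝ, V →L[ℝ] V) ∞ (fun g => ρ g)) (v : V) :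
    NormalSolution (homogeneousModel EG P) Γ ρ where
  σ g := (filtTop Γ ρ).mkQ (ρ g⁻¹ v)
  isSolution := (isParallelSection_homogeneousModel hρ v).isBGGSolution Γ
  s g := ρ g⁻¹ v
  isParallel := isParallelSection_homogeneousModel hρ v
  proj_eq _ := rfl

theorem hasGType_modelSolution (Γ : ParabolicGrading (EG := EG) (EP := EP) P)
    (hρ : ContMDiff 𝓘(ℝ, EG) 𝓘(ℝ, V →L[ℝ] V) ∞ (fun g => ρ g)) {O : Set V} (hO : IsOrbit ρ O)
    {v : V} (hv : v ∈ O) : (modelSolution Γ hρ v).HasGType O := by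
  refine ⟨hO, ?_⟩
  obtain ⟨w, rfl⟩ := hO
  obtain ⟨h, rfl⟩ := hv
  ext y
  constructor
  · rintro ⟨⟨g, k⟩, rfl⟩
    refine ⟨k⁻¹ * (g⁻¹ * h), ?_⟩
    change _ = ρ k⁻¹ (ρ g⁻¹ (ρ h w))
    simp only [rep_apply_apply]
  · rintro ⟨k, rfl⟩
    refine ⟨(h, k⁻¹), ?_⟩
    change ρ k⁻¹⁻¹ (ρ h⁻¹ (ρ h w)) = ρ k w
    simp [rep_apply_apply]

theorem pType_modelSolution (Γ : ParabolicGrading (EG := EG) (EP := EP) P)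
    (hρ : ContMDiff 𝓘(ℝ, EG) 𝓘(ℝ, V →L[ℝ] V) ∞ (fun g => ρ g)) (v : V) :
    (modelSolution Γ hρ v).pType ((1 : G) : G ⧸ P) = range fun p : P => ρ p v := by
  ext y
  constructor
  · rintro ⟨g, hg, rfl⟩
    have hgP : g⁻¹ * 1 ∈ P := (QuotientGroup.eq (s := P)).1 hg
    rw [mul_one] at hgP
    exact ⟨⟨g⁻¹, hgP⟩, rfl⟩
  · rintro ⟨p, rfl⟩
    refine ⟨(p : G)⁻¹, (QuotientGroup.eq (s := P)).2 (by simp), ?_⟩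
    change ρ (p : G)⁻¹⁻¹ v = ρ p v
    rw [inv_inv]

theorem mk_mem_zeroLocus_modelSolution (Γ : ParabolicGrading (EG := EG) (EP := EP) P)
    (hρ : ContMDiff 𝓘(ℝ, EG) 𝓘(ℝ, V →L[ℝ] V) ∞ (fun g => ρ g)) {v : V} {U : Submodule ℝ V}
    (hU : IsInvariant P ρ U) (g : G) :
    (g : G ⧸ P) ∈ (modelSolution Γ hρ v).zeroLocus U ↔ ρ g⁻¹ v ∈ U := by
  refine ⟨?_, fun h => ⟨g, rfl, h⟩⟩
  rintro ⟨h, hh, hmem⟩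
  have hp : g⁻¹ * h ∈ P := (QuotientGroup.eq (s := P)).1 (Eq.symm hh)
  have h1 : ρ (g⁻¹ * h) (ρ h⁻¹ v) ∈ U := hU _ hp _ hmem
  rwa [rep_apply_apply, mul_inv_cancel_right] at h1

end Model

/-! ### Tractor sections on the fibres of the bundle -/

section Fibres

variable {EG : Type*} [NormedAddCommGroup EG] [NormedSpace ℝ EG]
  {G : Type*} [TopologicalSpace G] [ChartedSpace EG G] [Group G]
  {EP : Type*} [NormedAddCommGroup EP] [NormedSpace ℝ EP]
  {P : Subgroup G} [ChartedSpace EP P]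
  {EB : Type*} [NormedAddCommGroup EB] [NormedSpace ℝ EB]
  {B : Type*} [TopologicalSpace B] [ChartedSpace EB B] [IsManifold 𝓘(ℝ, EB) ∞ B]
  {EM : Type*} [NormedAddCommGroup EM] [NormedSpace ℝ EM]
  {M : Type*} [TopologicalSpace M] [ChartedSpace EM M]
  {V : Type*} [NormedAddCommGroup V] [NormedSpace ℝ V]
  {C : CartanData EG P EB B M} {ρ : G →* (V →L[ℝ] V)}

theorem IsCartanGeometry.proj_act (hC : IsCartanGeometry EP EM C) (u : B) (p : P) :
    C.proj (C.act u p) = C.proj u := by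
  obtain ⟨N, Ψ, -, hxN, hsrc, htgt, -, -, hproj, hact⟩ := hC.locally_trivial (C.proj u)
  have hu : u ∈ Ψ.target := by rw [htgt]; exact hxN
  have hs := Ψ.map_target hu
  rw [hsrc] at hs
  obtain ⟨⟨y, q⟩, hyq⟩ : ∃ z, z = Ψ.symm u := ⟨_, rfl⟩
  have h1 : Ψ (y, q) = u := by rw [hyq]; exact Ψ.right_inv hu
  rw [← hyq] at hs
  rw [← h1, ← hact y hs.1, hproj y hs.1, hproj y hs.1]

/-- `P` acts transitively on the fibres. -/
theorem IsCartanGeometry.exists_act_eq (hC : IsCartanGeometry EP EM C) {u w : B}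
    (h : C.proj u = C.proj w) : ∃ p : P, C.act u p = w := by
  obtain ⟨N, Ψ, -, hxN, hsrc, htgt, -, -, hproj, hact⟩ := hC.locally_trivial (C.proj u)
  have key : ∀ w : B, C.proj w = C.proj u → ∃ q : P, w = Ψ (C.proj u, q) := by
    intro w hw
    have hu : w ∈ Ψ.target := by rw [htgt, mem_preimage, hw]; exact hxN
    have hs := Ψ.map_target hu
    rw [hsrc] at hs
    have h1 := hproj _ hs.1 (Ψ.symm w).2
    rw [Prod.mk.eta, Ψ.right_inv hu, hw] at h1
    refine ⟨(Ψ.symm w).2, ?_⟩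
    rw [h1, Prod.mk.eta, Ψ.right_inv hu]
  obtain ⟨q, hq⟩ := key u rfl
  obtain ⟨q', hq'⟩ := key w h.symm
  refine ⟨q⁻¹ * q', ?_⟩
  conv_lhs => rw [hq]
  rw [← hact _ hxN, mul_inv_cancel_left, ← hq']

theorem IsTractorSection.mem_iff_of_proj_eq (hC : IsCartanGeometry EP EM C) {s : B → V}
    (hs : IsTractorSection C ρ s) {U : Submodule ℝ V} (hU : IsInvariant P ρ U) {u w : B}
    (h : C.proj u = C.proj w) (hu : s u ∈ U) : s w ∈ U := by
  obtain ⟨p, rfl⟩ := hC.exists_act_eq h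
  rw [hs.equivariant]
  exact hU _ (inv_mem p.2) _ hu

theorem IsTractorSection.image_fibre (hC : IsCartanGeometry EP EM C) {s : B → V}
    (hs : IsTractorSection C ρ s) (u : B) :
    s '' {w | C.proj w = C.proj u} = range fun p : P => ρ p (s u) := by
  ext v
  constructor
  · rintro ⟨w, hw, rfl⟩
    obtain ⟨p, rfl⟩ := hC.exists_act_eq (Eq.symm hw)
    exact ⟨p⁻¹, by simp [hs.equivariant]⟩
  · rintro ⟨p, rfl⟩
    exact ⟨C.act u p⁻¹, hC.proj_act _ _, by simp [hs.equivariant]⟩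

end Fibres

/-- If `t` is complementary to the kernel of `p`, and `A` identifies the kernels of `p` and `q`, then
`q ∘ A ∘ t` is bijective. It is applied to the derivatives `t` of a section, `p` of the bundle
projection and `q` of `G → G/P`, with `A` the Cartan connection. -/
theorem bijective_comp_of_ker_iff {T 𝔤 K Q E : Type*} [AddCommGroup T] [Module ℝ T]
    [AddCommGroup 𝔤] [Module ℝ 𝔤] [AddCommGroup K] [Module ℝ K] [AddCommGroup Q] [Module ℝ Q]
    [AddCommGroup E] [Module ℝ E] {A : T →ₗ[ℝ] 𝔤} {p : T →ₗ[ℝ] K} {q : 𝔤 →ₗ[ℝ] Q} {t : E →ₗ[ℝ] T}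
    (hA : Function.Surjective A) (hq : Function.Surjective q)
    (hpt : Function.Bijective (p ∘ₗ t)) (h : ∀ ζ, p ζ = 0 ↔ q (A ζ) = 0) :
    Function.Bijective (q ∘ₗ A ∘ₗ t) := by
  constructor
  · rw [← LinearMap.ker_eq_bot, LinearMap.ker_eq_bot']
    intro ξ hξ
    exact (map_eq_zero_iff _ hpt.1).1 ((h (t ξ)).2 hξ)
  · intro y
    obtain ⟨X, rfl⟩ := hq y
    obtain ⟨ζ, rfl⟩ := hA X
    obtain ⟨ξ, hξ⟩ := hpt.2 (p ζ)
    refine ⟨ξ, sub_eq_zero.1 ?_⟩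
    have h1 := (h (t ξ - ζ)).1 (by rw [map_sub]; exact sub_eq_zero.2 hξ)
    rwa [map_sub, map_sub] at h1

/-! ### Vertical vectors and local sections -/

section Vertical

variable {EG : Type*} [NormedAddCommGroup EG] [NormedSpace ℝ EG]
  {G : Type*} [TopologicalSpace G] [ChartedSpace EG G] [Group G]
  {EP : Type*} [NormedAddCommGroup EP] [NormedSpace ℝ EP]
  {P : Subgroup G} [ChartedSpace EP P]
  {EB : Type*} [NormedAddCommGroup EB] [NormedSpace ℝ EB]
  {B : Type*} [TopologicalSpace B] [ChartedSpace EB B] [IsManifold 𝓘(ℝ, EB) ∞ B]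
  {EM : Type*} [NormedAddCommGroup EM] [NormedSpace ℝ EM]
  {M : Type*} [TopologicalSpace M] [ChartedSpace EM M]
  {C : CartanData EG P EB B M}

theorem IsCartanGeometry.hasMFDerivAt_proj (hC : IsCartanGeometry EP EM C) (u : B) :
    HasMFDerivAt 𝓘(ℝ, EB) 𝓘(ℝ, EM) C.proj u (mfderiv 𝓘(ℝ, EB) 𝓘(ℝ, EM) C.proj u) :=
  ((hC.contMDiff_proj u).mdifferentiableAt (by simp)).hasMFDerivAt

theorem IsCartanGeometry.contMDiff_act_right (hC : IsCartanGeometry EP EM C) (u : B) :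
    ContMDiff 𝓘(ℝ, EP) 𝓘(ℝ, EB) ∞ (fun p : P => C.act u p) :=
  hC.contMDiff_act.comp (contMDiff_const.prodMk contMDiff_id)

/-- The condition on fundamental vector fields, stated at `u` in place of `u · 1`. -/
theorem IsCartanGeometry.form_mfderiv_act (hC : IsCartanGeometry EP EM C) (u : B)
    (Y : GroupLieAlgebra 𝓘(ℝ, EP) P) :
    C.form u (mfderiv 𝓘(ℝ, EP) 𝓘(ℝ, EB) (fun p : P => C.act u p) 1 Y) =
      inclDeriv (EG := EG) P Y := by
  have key : ∀ u' (_ : u' = u) (ζ : EB), (C.form u' ζ : EG) = C.form u ζ := by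
    rintro _ rfl _
    rfl
  exact (key _ (hC.act_one u) _).symm.trans (hC.form_fundamental u Y)

/-- Every element of the Lie algebra of `P` is the value of `ω` on a vertical vector. -/
theorem IsCartanGeometry.exists_vertical (hC : IsCartanGeometry EP EM C) (u : B)
    (Y : GroupLieAlgebra 𝓘(ℝ, EP) P) :
    ∃ ζ : TangentSpace 𝓘(ℝ, EB) u, C.form u ζ = inclDeriv (EG := EG) P Y ∧
      mfderiv 𝓘(ℝ, EB) 𝓘(ℝ, EM) C.proj u ζ = 0 := by
  suffices h : ∃ ζ : TangentSpace 𝓘(ℝ, EB) (C.act u 1), C.form (C.act u 1) ζ =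
      inclDeriv (EG := EG) P Y ∧ mfderiv 𝓘(ℝ, EB) 𝓘(ℝ, EM) C.proj (C.act u 1) ζ = 0 by
    rwa [hC.act_one] at h
  refine ⟨_, hC.form_fundamental u Y, ?_⟩
  have h1 := HasMFDerivAt.comp (1 : P) (hC.hasMFDerivAt_proj (C.act u 1))
    ((hC.contMDiff_act_right u 1).mdifferentiableAt (by simp)).hasMFDerivAt
  have h2 : C.proj ∘ (fun p : P => C.act u p) = fun _ => C.proj u := by
    ext1 p
    exact hC.proj_act u p
  rw [h2] at h1
  exact DFunLike.congr_fun (hasMFDerivAt_unique h1 (hasMFDerivAt_const _ _)) Y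

/-- There is a smooth local section `τ` of the bundle near `x` such that `ω` maps the vertical vectors
at `τ x` into the Lie algebra of `P`. The section is `y ↦ Ψ(y, 1)` for a local trivialization `Ψ`,
and the vertical vectors at its values are fundamental because `Ψ(y, p) = Ψ(y, 1) · p`. -/
theorem IsCartanGeometry.exists_local_section (hC : IsCartanGeometry EP EM C) (x : M) :
    ∃ τ : M → B, (∀ᶠ y in 𝓝 x, ContMDiffAt 𝓘(ℝ, EM) 𝓘(ℝ, EB) ∞ τ y) ∧
      (∀ᶠ y in 𝓝 x, C.proj (τ y) = y) ∧
      ∀ ζ : TangentSpace 𝓘(ℝ, EB) (τ x), mfderiv 𝓘(ℝ, EB) 𝓘(ℝ, EM) C.proj (τ x) ζ = 0 →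
        ∃ Y : GroupLieAlgebra 𝓘(ℝ, EP) P, C.form (τ x) ζ = inclDeriv (EG := EG) P Y := by
  obtain ⟨N, Ψ, hNo, hxN, hsrc, htgt, hΨ, hΨs, hproj, hact⟩ := hC.locally_trivial x
  have hmem : ∀ y ∈ N, ∀ p : P, (y, p) ∈ Ψ.source := by
    intro y hy p
    rw [hsrc]
    exact ⟨hy, mem_univ _⟩
  refine ⟨fun y => Ψ (y, 1), ?_, ?_, ?_⟩
  · filter_upwards [hNo.mem_nhds hxN] with y hy
    exact (hΨ.contMDiffAt (Ψ.open_source.mem_nhds (hmem y hy 1))).comp y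
      (contMDiffAt_id.prodMk contMDiffAt_const)
  · filter_upwards [hNo.mem_nhds hxN] with y hy
    exact hproj y hy 1
  · intro ζ hζ
    have hx1 := hmem x hxN 1
    have hΨd : Ψ.MDifferentiable (𝓘(ℝ, EM).prod 𝓘(ℝ, EP)) 𝓘(ℝ, EB) :=
      ⟨hΨ.mdifferentiableOn (by simp), hΨs.mdifferentiableOn (by simp)⟩
    have hΨ' := (hΨd.mdifferentiableAt hx1).hasMFDerivAt
    obtain ⟨w, rfl⟩ := hΨd.mfderiv_surjective hx1 ζ
    have h1 := HasMFDerivAt.comp (x, (1 : P)) (hC.hasMFDerivAt_proj (Ψ (x, 1))) hΨ'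
    have h2 : Prod.fst =ᶠ[𝓝 (x, (1 : P))] C.proj ∘ Ψ := by
      filter_upwards [Ψ.open_source.mem_nhds hx1] with z hz
      rw [hsrc] at hz
      exact (hproj z.1 hz.1 z.2).symm
    have h3 := DFunLike.congr_fun (hasMFDerivAt_unique (h1.congr_of_eventuallyEq h2)
      (hasMFDerivAt_fst (I := 𝓘(ℝ, EM)) (I' := 𝓘(ℝ, EP)) (x, (1 : P)))) w
    have hw1 : w.1 = 0 := h3.symm.trans hζ
    have h4 : MDifferentiableAt 𝓘(ℝ, EP) (𝓘(ℝ, EM).prod 𝓘(ℝ, EP)) (fun p : P => (x, p)) 1 :=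
      mdifferentiableAt_const.prodMk mdifferentiableAt_id
    have h5 := HasMFDerivAt.comp (1 : P) (hΨd.mdifferentiableAt hx1).hasMFDerivAt h4.hasMFDerivAt
    have h6 : Ψ ∘ (fun p : P => (x, p)) = fun p : P => C.act (Ψ (x, 1)) p := by
      ext1 p
      simpa using hact x hxN 1 p
    rw [h6, mfderiv_prod_right] at h5
    let Y : GroupLieAlgebra 𝓘(ℝ, EP) P := w.2
    have h7 : mfderiv 𝓘(ℝ, EP) 𝓘(ℝ, EB) (fun p : P => C.act (Ψ (x, 1)) p) 1 Y =
        mfderiv (𝓘(ℝ, EM).prod 𝓘(ℝ, EP)) 𝓘(ℝ, EB) Ψ (x, 1) w := by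
      have hw : ContinuousLinearMap.inr ℝ EM EP Y = w := Prod.ext hw1.symm rfl
      refine (DFunLike.congr_fun h5.mfderiv Y).trans ?_
      exact congrArg (mfderiv (𝓘(ℝ, EM).prod 𝓘(ℝ, EP)) 𝓘(ℝ, EB) Ψ (x, 1)) hw
    refine ⟨Y, ?_⟩
    rw [← hC.form_mfderiv_act]
    exact congrArg (C.form (Ψ (x, 1))) h7.symm

end Vertical

/-! ### Comparison with the homogeneous model -/

section LocalDiffeo

variable {EG : Type*} [NormedAddCommGroup EG] [NormedSpace ℝ EG] [FiniteDimensional ℝ EG]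
  {G : Type*} [TopologicalSpace G] [ChartedSpace EG G] [Group G] [LieGroup 𝓘(ℝ, EG) ∞ G]
  {EP : Type*} [NormedAddCommGroup EP] [NormedSpace ℝ EP]
  {P : Subgroup G} [ChartedSpace EP P]
  {EQ : Type*} [NormedAddCommGroup EQ] [NormedSpace ℝ EQ]
  [ChartedSpace EQ (G ⧸ P)] [IsManifold 𝓘(ℝ, EQ) ∞ (G ⧸ P)]
  {EB : Type*} [NormedAddCommGroup EB] [NormedSpace ℝ EB]
  {B : Type*} [TopologicalSpace B] [ChartedSpace EB B] [IsManifold 𝓘(ℝ, EB) ∞ B]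
  {EM : Type*} [NormedAddCommGroup EM] [NormedSpace ℝ EM] [FiniteDimensional ℝ EM]
  {M : Type*} [TopologicalSpace M] [ChartedSpace EM M] [IsManifold 𝓘(ℝ, EM) ∞ M]
  {V : Type*} [NormedAddCommGroup V] [NormedSpace ℝ V] [FiniteDimensional ℝ V]
  {C : CartanData EG P EB B M} {ρ : G →* (V →L[ℝ] V)}

/-- Near `x` there is a diffeomorphism onto an open subset of `G/P` such that over corresponding
points the parallel section `s` and the section `g ↦ ρ(g⁻¹) s(u)` of the model, where `u` lies
over `x`, share a value. -/
theorem exists_local_comparison (hP : IsClosedLieSubgroup (EG := EG) (EP := EP) P)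
    (hQ : Manifold.IsSubmersion 𝓘(ℝ, EG) 𝓘(ℝ, EQ) ∞ (fun g : G => (g : G ⧸ P)))
    (hρ : ContMDiff 𝓘(ℝ, EG) 𝓘(ℝ, V →L[ℝ] V) ∞ (fun g => ρ g))
    (hC : IsCartanGeometry EP EM C) {s : B → V} (hs : IsParallelSection C ρ s) (x : M) :
    ∃ (u : B) (φ : OpenPartialHomeomorph M (G ⧸ P)), C.proj u = x ∧ x ∈ φ.source ∧
      φ x = ((1 : G) : G ⧸ P) ∧
      ContMDiffOn 𝓘(ℝ, EM) 𝓘(ℝ, EQ) ∞ φ φ.source ∧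
      ContMDiffOn 𝓘(ℝ, EQ) 𝓘(ℝ, EM) ∞ φ.symm φ.target ∧
      ∀ y ∈ φ.source, ∃ (w : B) (g : G), C.proj w = y ∧ φ y = (g : G ⧸ P) ∧
        s w = ρ g⁻¹ (s u) := by
  obtain ⟨τ, hτ, hτp, hvert⟩ := hC.exists_local_section x
  set c := chartAt EM x with hc
  have hxc : x ∈ c.source := mem_chart_source EM x
  have hcx : c x ∈ c.target := c.map_source hxc
  have hsymm : c.symm (c x) = x := c.left_inv hxc
  have htend : Tendsto c.symm (𝓝 (c x)) (𝓝 x) := by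
    have := c.continuousAt_symm hcx
    rwa [ContinuousAt, hsymm] at this
  have hσ : ∀ᶠ z in 𝓝 (c x), ContMDiffAt 𝓘(ℝ, EM) 𝓘(ℝ, EB) ∞ (τ ∘ c.symm) z := by
    filter_upwards [htend.eventually hτ, c.open_target.mem_nhds hcx] with z hz hzt
    exact hz.comp z (contMDiffOn_chart_symm.contMDiffAt (c.open_target.mem_nhds hzt))
  obtain ⟨g, hg0, hgs, hg', hsg⟩ := exists_local_lift hρ hC.contMDiff_form hs hσ
  have hτ' := (hσ.self_of_nhds.mdifferentiableAt (by simp)).hasMFDerivAt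
  set τ' := mfderiv 𝓘(ℝ, EM) 𝓘(ℝ, EB) (τ ∘ c.symm) (c x)
  -- The section is transverse to the fibres.
  have hpτ : Function.Bijective fun ξ =>
      mfderiv 𝓘(ℝ, EB) 𝓘(ℝ, EM) C.proj (τ (c.symm (c x))) (τ' ξ) := by
    have h1 := HasMFDerivAt.comp (c x) (hC.hasMFDerivAt_proj (τ (c.symm (c x)))) hτ'
    have h2 : c.symm =ᶠ[𝓝 (c x)] C.proj ∘ (τ ∘ c.symm) := by
      filter_upwards [htend.eventually hτp] with z hz
      exact hz.symm
    have h3 := (h1.congr_of_eventuallyEq h2).mfderiv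
    have h4 := (mdifferentiable_chart (I := 𝓘(ℝ, EM)) x).symm.mfderiv_bijective hcx
    rw [← hc, h3] at h4
    exact h4
  have hker : ∀ ζ, mfderiv 𝓘(ℝ, EB) 𝓘(ℝ, EM) C.proj (τ (c.symm (c x))) ζ = 0 ↔
      mfderiv 𝓘(ℝ, EG) 𝓘(ℝ, EQ) (fun g : G => (g : G ⧸ P)) 1
        (C.form (τ (c.symm (c x))) ζ) = 0 := by
    rw [hsymm]
    intro ζ
    constructor
    · intro hζ
      obtain ⟨Y, hY⟩ := hvert ζ hζ
      rw [hY]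
      exact mfderiv_mk_inclDeriv hP hQ Y
    · intro hζ
      obtain ⟨Y, hY⟩ := exists_inclDeriv_eq_of_mfderiv_mk_eq_zero hP hQ hζ
      obtain ⟨ζ', hζ', h0⟩ := hC.exists_vertical (τ x) Y
      rw [(hC.form_bijective (τ x)).1 (hζ'.trans hY)] at h0
      exact h0
  have hπ : ContMDiff 𝓘(ℝ, EG) 𝓘(ℝ, EQ) ∞ (fun g : G => (g : G ⧸ P)) := hQ.contMDiff
  have hfs : ∀ᶠ z in 𝓝 (c x),
      ContMDiffAt 𝓘(ℝ, EM) 𝓘(ℝ, EQ) ∞ ((fun g : G => (g : G ⧸ P)) ∘ g) z :=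
    hgs.mono fun z hz => (hπ (g z)).comp z hz
  have hπ1 : HasMFDerivAt 𝓘(ℝ, EG) 𝓘(ℝ, EQ) (fun g : G => (g : G ⧸ P)) (g (c x))
      (mfderiv 𝓘(ℝ, EG) 𝓘(ℝ, EQ) (fun g : G => (g : G ⧸ P)) 1) := by
    rw [hg0]
    exact ((hπ 1).mdifferentiableAt (by simp)).hasMFDerivAt
  have hf' := HasMFDerivAt.comp (c x) hπ1 hg'
  have hbij := bijective_comp_of_ker_iff
    (A := (C.form (τ (c.symm (c x)))).toLinearMap)
    (p := (mfderiv 𝓘(ℝ, EB) 𝓘(ℝ, EM) C.proj (τ (c.symm (c x)))).toLinearMap)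
    (q := (mfderiv 𝓘(ℝ, EG) 𝓘(ℝ, EQ) (fun g : G => (g : G ⧸ P)) 1).toLinearMap)
    (t := τ'.toLinearMap) (hC.form_bijective _).2 (hQ.isSubmersionAt 1).mfderiv_surjective
    hpτ hker
  obtain ⟨ψ, hψx, hψf, hψs, hψs'⟩ := exists_local_diffeomorphism hfs hf' hbij
  obtain ⟨W, hW, hWo, hxW⟩ := eventually_nhds_iff.1 (hsg.and (htend.eventually hτp))
  let χ := ψ.restrOpen W hWo
  have hχt : χ.target ⊆ ψ.target := fun q hq => hq.1
  refine ⟨τ x, c.trans χ, hτp.self_of_nhds, ⟨hxc, hψx, hxW⟩, ?_, ?_, ?_, ?_⟩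
  · change ψ (c x) = _
    rw [hψf hψx, Function.comp, hg0]
  · intro y hy
    exact ((hψs.contMDiffAt (ψ.open_source.mem_nhds hy.2.1)).comp y
      (contMDiffOn_chart.contMDiffAt (c.open_source.mem_nhds hy.1))).contMDiffWithinAt
  · intro q hq
    exact ((contMDiffOn_chart_symm.contMDiffAt (c.open_target.mem_nhds hq.2)).comp q
      (hψs'.contMDiffAt (ψ.open_target.mem_nhds (hχt hq.1)))).contMDiffWithinAt
  · intro y hy
    obtain ⟨h1, h2⟩ := hW (c y) hy.2.2
    rw [c.left_inv hy.1] at h2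
    refine ⟨τ y, g (c y), h2, hψf hy.2.1, ?_⟩
    simpa only [Function.comp, hsymm, c.left_inv hy.1] using h1

end LocalDiffeo

end BGG

theorem mainTheorem2
    -- the Lie group `G`, semisimple
    {EG : Type*} [NormedAddCommGroup EG] [NormedSpace ℝ EG] [FiniteDimensional ℝ EG]
    [CompleteSpace EG]
    {G : Type*} [TopologicalSpace G] [T2Space G] [ChartedSpace EG G] [Group G]
    [LieGroup 𝓘(ℝ, EG) ∞ G] [LieAlgebra.IsSemisimple ℝ (GroupLieAlgebra 𝓘(ℝ, EG) G)]
    -- the parabolic subgroup `P`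
    {EP : Type*} [NormedAddCommGroup EP] [NormedSpace ℝ EP] [FiniteDimensional ℝ EP]
    (P : Subgroup G) [ChartedSpace EP P] [LieGroup 𝓘(ℝ, EP) ∞ P]
    (hP : BGG.IsClosedLieSubgroup (EG := EG) (EP := EP) P)
    (Γ : BGG.ParabolicGrading (EG := EG) (EP := EP) P)
    -- the homogeneous space `G/P` with its manifold structure, for which `G → G/P` is a submersion
    {EQ : Type*} [NormedAddCommGroup EQ] [NormedSpace ℝ EQ] [FiniteDimensional ℝ EQ]
    [ChartedSpace EQ (G ⧸ P)] [IsManifold 𝓘(ℝ, EQ) ∞ (G ⧸ P)]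
    (hQ : Manifold.IsSubmersion 𝓘(ℝ, EG) 𝓘(ℝ, EQ) ∞ (fun g : G => (g : G ⧸ P)))
    -- the irreducible representation `V`, over `𝕜 = ℝ` or `𝕜 = ℂ`
    {𝕜 : Type*} [RCLike 𝕜] {V : Type*} [NormedAddCommGroup V] [NormedSpace ℝ V]
    [FiniteDimensional ℝ V] [Module 𝕜 V] [IsScalarTower ℝ 𝕜 V]
    (ρ : G →* (V →L[ℝ] V))
    (hρ : ContMDiff 𝓘(ℝ, EG) 𝓘(ℝ, V →L[ℝ] V) ∞ (fun g => ρ g))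
    (hirr : BGG.IsIrreducibleRep 𝕜 ρ)
    -- the parabolic geometry `(B → M, ω)`
    {EM : Type*} [NormedAddCommGroup EM] [NormedSpace ℝ EM] [FiniteDimensional ℝ EM]
    {M : Type*} [TopologicalSpace M] [T2Space M] [ChartedSpace EM M] [IsManifold 𝓘(ℝ, EM) ∞ M]
    {EB : Type*} [NormedAddCommGroup EB] [NormedSpace ℝ EB] [FiniteDimensional ℝ EB]
    {B : Type*} [TopologicalSpace B] [T2Space B] [ChartedSpace EB B] [IsManifold 𝓘(ℝ, EB) ∞ B]
    (C : BGG.CartanData EG P EB B M) (hC : BGG.IsCartanGeometry EP EM C)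
    -- a normal solution of `G`-type `O`, and a point
    (σ : BGG.NormalSolution C Γ ρ) (O : Set V) (hO : σ.HasGType O) (x : M) :
    ∃ σ' : BGG.NormalSolution (BGG.homogeneousModel EG P) Γ ρ,
      σ'.HasGType O ∧
      σ'.pType ((1 : G) : G ⧸ P) = σ.pType x ∧
      ∃ φ : OpenPartialHomeomorph M (G ⧸ P),
        x ∈ φ.source ∧ φ x = ((1 : G) : G ⧸ P) ∧
        ContMDiffOn 𝓘(ℝ, EM) 𝓘(ℝ, EQ) ∞ φ φ.source ∧
        ContMDiffOn 𝓘(ℝ, EQ) 𝓘(ℝ, EM) ∞ φ.symm φ.target ∧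
        ∀ U : Submodule ℝ V, BGG.IsInvariant P ρ U →
          φ '' (σ.zeroLocus U ∩ φ.source) = σ'.zeroLocus U ∩ φ.target := by
  obtain ⟨u, φ, hux, hxφ, hφx, hφs, hφs', hcomp⟩ :=
    BGG.exists_local_comparison (EQ := EQ) hP hQ hρ hC σ.isParallel x
  have hsO : σ.s u ∈ O := by
    rw [← hO.2]
    exact ⟨(u, 1), by simp⟩
  have hs := σ.isParallel.toIsTractorSection
  refine ⟨BGG.modelSolution Γ hρ (σ.s u), BGG.hasGType_modelSolution Γ hρ hO.1 hsO, ?_, φ, hxφ,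
    hφx, hφs, hφs', fun U hU => ?_⟩
  · rw [BGG.pType_modelSolution, BGG.NormalSolution.pType, ← hux, hs.image_fibre hC]
  · have key : ∀ y ∈ φ.source,
        y ∈ σ.zeroLocus U ↔ φ y ∈ (BGG.modelSolution Γ hρ (σ.s u)).zeroLocus U := by
      intro y hy
      obtain ⟨w, g, hwy, hφy, hwg⟩ := hcomp y hy
      rw [hφy, BGG.mk_mem_zeroLocus_modelSolution Γ hρ hU, ← hwg]
      constructor
      · rintro ⟨w', hw', hmem⟩
        exact hs.mem_iff_of_proj_eq hC hU (hw'.trans hwy.symm) hmem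
      · exact fun hmem => ⟨w, hwy, hmem⟩
    ext q
    constructor
    · rintro ⟨y, ⟨hyZ, hy⟩, rfl⟩
      exact ⟨(key y hy).1 hyZ, φ.map_source hy⟩
    · rintro ⟨hqZ, hq⟩
      refine ⟨φ.symm q, ⟨(key _ (φ.map_target hq)).2 ?_, φ.map_target hq⟩, φ.right_inv hq⟩
      rwa [φ.right_inv hq]
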